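/- Let $d\ge 1$ and let $C_d=[-1,1]^d\subset\mathbb{R}^d$. A slice of $C_d$ is a set $Q=C_d\cap H$, where $H=\{x\in\mathbb{R}^d : \langle u,x\rangle=t\}$ with $u\neq 0$ is an affine hyperplane, such that $\dim Q=d-1$. The graph of a polytope is the abstract graph formed by its vertices and edges. Two polytopes are combinatorially equivalent if their face lattices are isomorphic. Let $Q$ be a slice of $C_d$ that contains at most two vertices of $C_d$. Then $Q$ is reconstructible from its graph: every $(d-1)$-dimensional polytope $P$ (in $\mathbb{R}^n$, for any $n$) whose graph is isomorphic to the graph of $Q$ is combinatorially equivalent to $Q$. -/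

import Mathlib

namespace CubeSlice

/-- A (convex) polytope in `ℝⁿ`: the convex hull of a finite set of points. -/
def IsPolytope {n : ℕ} (P : Set (Fin n → ℝ)) : Prop :=
  ∃ s : Set (Fin n → ℝ), s.Finite ∧ P = convexHull ℝ s

/-- `P` has (affine) dimension `k`: it is nonempty and the direction of its affine hull has
dimension `k`. (The empty set has no dimension in `ℕ`.) -/
def HasDim {n : ℕ} (P : Set (Fin n → ℝ)) (k : ℕ) : Prop :=
  P.Nonempty ∧ Module.finrank ℝ (vectorSpan ℝ P) = k

/-- The face poset of `P`, ordered by inclusion. A face is the empty set or the set of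
maximizers over `P` of a linear functional; the zero functional gives `P` itself. -/
abbrev Face {n : ℕ} (P : Set (Fin n → ℝ)) : Type :=
  {F : Set (Fin n → ℝ) // IsExposed ℝ P F}

/-- Combinatorial equivalence: the face lattices are isomorphic. -/
def CombEquiv {m n : ℕ} (P : Set (Fin m → ℝ)) (Q : Set (Fin n → ℝ)) : Prop :=
  Nonempty (Face P ≃o Face Q)

/-- The vertices of `P`: the points `v` such that `{v}` is a face. -/
def vertices {n : ℕ} (P : Set (Fin n → ℝ)) : Set (Fin n → ℝ) :=
  {v | IsExposed ℝ P {v}}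

/-- The vertex-edge graph of `P`: two distinct vertices are adjacent when the segment joining
them is a face (an edge) of `P`. -/
def graph {n : ℕ} (P : Set (Fin n → ℝ)) : SimpleGraph (vertices P) where
  Adj v w := v ≠ w ∧ IsExposed ℝ P (segment ℝ (v : Fin n → ℝ) (w : Fin n → ℝ))
  symm := ⟨fun v w h => ⟨h.1.symm, by rw [segment_symm]; exact h.2⟩⟩
  loopless := ⟨fun _ h => h.1 rfl⟩

/-- `Q` is reconstructible from its graph: every polytope of the same dimension, in a real space
of any dimension, whose graph is isomorphic to that of `Q` is combinatorially equivalent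
to `Q`. -/
def ReconstructibleFromGraph {m : ℕ} (Q : Set (Fin m → ℝ)) : Prop :=
  ∀ k : ℕ, HasDim Q k → ∀ (n : ℕ) (P : Set (Fin n → ℝ)), IsPolytope P → HasDim P k →
    Nonempty (graph P ≃g graph Q) → CombEquiv P Q

/-- The cube `[-1,1]^d`. -/
def cube (d : ℕ) : Set (Fin d → ℝ) :=
  {x | ∀ i, -1 ≤ x i ∧ x i ≤ 1}

/-- A slice of the `d`-cube: a `(d-1)`-dimensional intersection of the cube with an affine
hyperplane `{x | ⟨u, x⟩ = t}`, where `u ≠ 0`. -/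
def IsSlice (d : ℕ) (Q : Set (Fin d → ℝ)) : Prop :=
  ∃ (u : Fin d → ℝ) (t : ℝ), u ≠ 0 ∧ Q = cube d ∩ {x | u ⬝ᵥ x = t} ∧ HasDim Q (d - 1)

end CubeSlice

namespace CubeSlice

set_option linter.unusedSectionVars false

/-! A vertex of the slice that is not a vertex of the cube lies inside a cube edge transversal to
the hyperplane. Every edge of the slice at such a point leaves exactly one of the d - 1 cube facets
through it, so its degree is d - 1 and it is simple (`card_nbr_of_not_vertex`). It remains to show
that a polytope whose vertices other than v and w are simple is determined by its graph
(`AlmostSimplePair.isFace_iff`). Polytopes are replaced by the cones over them, with faces recorded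
as vertex sets.

For faces missing v or w, Kalai's counting argument is adapted. Given an ordering of the vertices,
count pairs of a face and a local maximum on it, ignoring those at w and those at v on faces through
w. A simple vertex contributes a number that depends only on the graph and the ordering. Every
nonempty face off w has such a pair, and a good ordering with w last gives exactly one. If v is
first, its contribution is trivial, so two realizations have equally many faces off w, and an
ordering good for one has no superfluous pairs for the other. Taking a face F as an initial segment
then forces F to be a face of the other realization (`AlmostSimplePair.isFace_of_notMem`).

For a face through both v and w, start at a simple vertex x of it and take the face of the other
realization with the same edges at x. Agreement of edges spreads along the graph of the face without
v and w, by way of 2-faces already known to be common. This graph is connected if vw is an edge or,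
as in Balinski's theorem, if the face has dimension at least three; polygons are treated separately.
-/

open scoped Classical in
/-- The neighbours of `i` in `G`, as a finset. -/
noncomputable def nbr {V : Type*} [Fintype V] (G : SimpleGraph V) (i : V) : Finset V :=
  Finset.univ.filter (G.Adj i)

/-- A set of generators of the cone spanned by `p` is a face if it is the zero set of a
linear functional that is nonnegative on the cone. -/
def IsFace {V W : Type*} [AddCommGroup W] [Module ℝ W] (p : V → W) (A : Finset V) : Prop :=
  ∃ l : Module.Dual ℝ W, (∀ i, 0 ≤ l (p i)) ∧ ∀ i, l (p i) = 0 ↔ i ∈ A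

/-- The vectors `p i` span the distinct extreme rays of a pointed cone, and `G` is the graph whose
edges are the two-dimensional faces of this cone. -/
structure Realizes {V W : Type*} [DecidableEq V] [AddCommGroup W] [Module ℝ W]
    (G : SimpleGraph V) (p : V → W) : Prop where
  pos : ∃ e : Module.Dual ℝ W, ∀ i, 0 < e (p i)
  vertex : ∀ i, IsFace p {i}
  adj_iff : ∀ i j, G.Adj i j ↔ i ≠ j ∧ IsFace p {i, j}

/-! ### Faces, edges and simple vertices of a pointed cone -/

section Config

variable {V W : Type*} [Fintype V] [DecidableEq V] [AddCommGroup W] [Module ℝ W]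
  {G : SimpleGraph V} {p : V → W}

@[simp] lemma mem_nbr {i j : V} : j ∈ nbr G i ↔ G.Adj i j := by simp [nbr]

lemma isFace_univ : IsFace p Finset.univ := ⟨0, by simp, by simp⟩

lemma IsFace.inter {A B : Finset V} (hA : IsFace p A) (hB : IsFace p B) : IsFace p (A ∩ B) := by
  obtain ⟨l, hl, hl'⟩ := hA
  obtain ⟨m, hm, hm'⟩ := hB
  refine ⟨l + m, fun i => add_nonneg (hl i) (hm i), fun i => ?_⟩
  rw [Finset.mem_inter, ← hl', ← hm']
  exact add_eq_zero_iff_of_nonneg (hl i) (hm i)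

/-- A face of a face is a face. -/
lemma IsFace.sub {A B : Finset V} (hA : IsFace p A) (m : Module.Dual ℝ W)
    (hm : ∀ i ∈ A, 0 ≤ m (p i)) (hB : ∀ i, i ∈ B ↔ i ∈ A ∧ m (p i) = 0) : IsFace p B := by
  obtain ⟨l, hl, hl'⟩ := hA
  -- This bound makes `M * l + m` at least 1 off `A`; the terms from `A`, where the divisor is zero,
  -- are harmless.
  obtain ⟨M, hM⟩ := (Set.finite_range fun i => (1 - m (p i)) / l (p i)).bddAbove
  have hpos : ∀ i, i ∉ A → 0 < M * l (p i) + m (p i) := by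
    intro i hi
    have h1 : 0 < l (p i) := lt_of_le_of_ne (hl i) fun h => hi ((hl' i).1 h.symm)
    have h2 : (1 - m (p i)) / l (p i) ≤ M := hM ⟨i, rfl⟩
    rw [div_le_iff₀ h1] at h2
    linarith
  refine ⟨M • l + m, fun i => ?_, fun i => ?_⟩ <;>
    simp only [LinearMap.add_apply, LinearMap.smul_apply, smul_eq_mul]
  · by_cases hi : i ∈ A
    · simpa [(hl' i).2 hi] using hm i hi
    · exact (hpos i hi).le
  · rw [hB]
    by_cases hi : i ∈ A
    · simp [(hl' i).2 hi, hi]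
    · simp [hi, (hpos i hi).ne']

/-- The nonnegative functional whose zero set among the generators is `{i}`. -/
lemma Realizes.exists_vertex (h : Realizes G p) (i : V) :
    ∃ l : Module.Dual ℝ W, l (p i) = 0 ∧ ∀ j, j ≠ i → 0 < l (p j) := by
  obtain ⟨l, hl, hl'⟩ := h.vertex i
  refine ⟨l, (hl' i).2 (by simp), fun j hj => lt_of_le_of_ne (hl j) fun h0 => hj ?_⟩
  simpa using (hl' j).1 h0.symm

/-- The smallest ratio `m / L` over `A \ {i}` cuts out a face of `A` through `i`. -/
lemma exists_min_ratio {A : Finset V} (hA : IsFace p A) {i : V} (hi : i ∈ A)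
    {L m : Module.Dual ℝ W} (hLi : L (p i) = 0) (hL : ∀ j, j ≠ i → 0 < L (p j))
    (hmi : m (p i) = 0) (hne : ∃ j ∈ A, j ≠ i) :
    ∃ c : ℝ, ∃ B : Finset V, IsFace p B ∧ i ∈ B ∧ (∃ j ∈ B, j ≠ i) ∧
      (∀ j, j ∈ B ↔ j ∈ A ∧ m (p j) = c * L (p j)) ∧ ∀ j ∈ A, c * L (p j) ≤ m (p j) := by
  obtain ⟨j0, hj0, hj0'⟩ := hne
  obtain ⟨y, hy, hmin⟩ := (A.erase i).exists_min_image (fun j => m (p j) / L (p j))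
    ⟨j0, by simp [hj0, hj0']⟩
  simp only [Finset.mem_erase] at hy hmin
  have hle : ∀ j ∈ A, m (p y) / L (p y) * L (p j) ≤ m (p j) := by
    intro j hj
    by_cases hji : j = i
    · simp [hji, hLi, hmi]
    · have := hmin j ⟨hji, hj⟩
      rwa [le_div_iff₀ (hL j hji)] at this
  refine ⟨m (p y) / L (p y), A.filter (fun j => m (p j) = m (p y) / L (p y) * L (p j)),
    hA.sub (m - (m (p y) / L (p y)) • L) ?_ ?_, by simp [hi, hLi, hmi], ⟨y, ?_, hy.1⟩, by simp, hle⟩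
  · intro j hj
    simpa using hle j hj
  · intro j
    simp [sub_eq_zero]
  · have := (hL y hy.1).ne'
    simp [hy.2, this]

/-- Every face with at least two vertices has an edge at each of its vertices. -/
lemma Realizes.exists_edge (h : Realizes G p) {i : V} (A : Finset V) (hA : IsFace p A)
    (hi : i ∈ A) (hne : ∃ j ∈ A, j ≠ i) : ∃ y ∈ A, G.Adj i y := by
  induction A using Finset.strongInduction with
  | H A ih =>
  obtain ⟨j, hj, hji⟩ := hne
  by_cases hA2 : A = {i, j}
  · exact ⟨j, hj, (h.adj_iff i j).2 ⟨hji.symm, hA2 ▸ hA⟩⟩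
  obtain ⟨z, hz, hzi, hzj⟩ : ∃ z ∈ A, z ≠ i ∧ z ≠ j := by
    by_contra! hcon
    refine hA2 (Finset.Subset.antisymm (fun z hz => ?_) (by simp [Finset.insert_subset_iff, hi, hj]))
    by_cases hzi : z = i
    · simp [hzi]
    · simp [hcon z hz hzi]
  obtain ⟨L, hLi, hL⟩ := h.exists_vertex i
  have hLj := hL j hji
  have hLz := hL z hzi
  -- If this were `c • p i`, a supporting functional vanishing only at `j` (for `c ≥ 0`) or only at
  -- `z` (for `c ≤ 0`) would take values of incompatible signs on the two sides.
  have hnot : L (p z) • p j - L (p j) • p z ∉ Submodule.span ℝ {p i} := by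
    intro hmem
    obtain ⟨c, hc⟩ := Submodule.mem_span_singleton.1 hmem
    rcases le_total 0 c with hc0 | hc0
    · obtain ⟨l, hl0, hl⟩ := h.exists_vertex j
      have h1 := congrArg l hc
      simp only [map_smul, map_sub, hl0, smul_eq_mul] at h1
      nlinarith [hl i hji.symm, hl z hzj, mul_pos hLj (hl z hzj),
        mul_nonneg hc0 (hl i hji.symm).le]
    · obtain ⟨l, hl0, hl⟩ := h.exists_vertex z
      have h1 := congrArg l hc
      simp only [map_smul, map_sub, hl0, smul_eq_mul] at h1
      nlinarith [hl i hzi.symm, hl j hzj.symm, mul_pos hLz (hl j hzj.symm),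
        mul_nonneg (neg_nonneg.2 hc0) (hl i hzi.symm).le]
  obtain ⟨m, hm, hker⟩ := Submodule.exists_le_ker_of_notMem hnot
  have hmi : m (p i) = 0 := hker (Submodule.mem_span_singleton_self _)
  -- The ratios `m / L` at `j` and `z` differ, so the face of smallest ratio is a proper one and the
  -- induction applies.
  obtain ⟨c, B, hB, hiB, hneB, hmem, -⟩ := exists_min_ratio hA hi hLi hL hmi ⟨j, hj, hji⟩
  have hBA : B ⊆ A := fun x hx => ((hmem x).1 hx).1
  have hss : B ⊂ A := by
    refine Finset.ssubset_iff_subset_ne.2 ⟨hBA, fun hEq => hm ?_⟩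
    have h1 := ((hmem j).1 (hEq ▸ hj)).2
    have h2 := ((hmem z).1 (hEq ▸ hz)).2
    simp only [map_sub, map_smul, smul_eq_mul, h1, h2]
    ring
  obtain ⟨y, hy, hadj⟩ := ih B hss hB hiB hneB
  exact ⟨y, hBA hy, hadj⟩

/-- Local minimality in the graph of a face implies global minimality on this face. -/
lemma Realizes.nonneg_of_nbr (h : Realizes G p) {A : Finset V} (hA : IsFace p A) {i : V}
    (hi : i ∈ A) (g : Module.Dual ℝ W) (hgi : g (p i) = 0)
    (hg : ∀ y ∈ A, G.Adj i y → 0 ≤ g (p y)) : ∀ j ∈ A, 0 ≤ g (p j) := by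
  intro j hj
  by_cases hji : j = i
  · simp [hji, hgi]
  obtain ⟨L, hLi, hL⟩ := h.exists_vertex i
  -- The face where `g / L` attains its minimum `c` has an edge at `i`, and the hypothesis at the
  -- other end of this edge gives `0 ≤ c`.
  obtain ⟨c, B, hB, hiB, hneB, hmem, hle⟩ := exists_min_ratio hA hi hLi hL hgi ⟨j, hj, hji⟩
  obtain ⟨y, hy, hadj⟩ := h.exists_edge B hB hiB hneB
  have h1 := (hmem y).1 hy
  have h2 := hg y h1.1 hadj
  have h3 := hL y hadj.ne'
  rw [h1.2] at h2
  have hc : 0 ≤ c := nonneg_of_mul_nonneg_left h2 h3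
  exact (mul_nonneg hc (hL j hji).le).trans (hle j hj)

lemma Realizes.eq_zero_of_nbr (h : Realizes G p) {A : Finset V} (hA : IsFace p A) {i : V}
    (hi : i ∈ A) (g : Module.Dual ℝ W) (hgi : g (p i) = 0)
    (hg : ∀ y ∈ A, G.Adj i y → g (p y) = 0) : ∀ j ∈ A, g (p j) = 0 := by
  intro j hj
  have h1 := h.nonneg_of_nbr hA hi g hgi (fun y hy ha => (hg y hy ha).ge) j hj
  have h2 := h.nonneg_of_nbr hA hi (-g) (by simp [hgi])
    (fun y hy ha => by simp [hg y hy ha]) j hj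
  simp only [LinearMap.neg_apply] at h2
  linarith

/-- A face through a vertex `i` is determined by its neighbours of `i`. -/
lemma Realizes.subset_of_nbr (h : Realizes G p) {A B : Finset V} (hA : IsFace p A)
    (hB : IsFace p B) {i : V} (hiA : i ∈ A) (hiB : i ∈ B)
    (hAB : ∀ y, G.Adj i y → y ∈ A → y ∈ B) : A ⊆ B := by
  obtain ⟨l, hl, hl'⟩ := hB
  have := h.eq_zero_of_nbr hA hiA l ((hl' i).2 hiB) fun y hy ha => (hl' y).2 (hAB y ha hy)
  exact fun j hj => (hl' j).1 (this j hj)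

lemma Realizes.eq_of_nbr (h : Realizes G p) {A B : Finset V} (hA : IsFace p A)
    (hB : IsFace p B) {i : V} (hiA : i ∈ A) (hiB : i ∈ B)
    (hAB : ∀ y, G.Adj i y → (y ∈ A ↔ y ∈ B)) : A = B :=
  Finset.Subset.antisymm (h.subset_of_nbr hA hB hiA hiB fun y hy => (hAB y hy).1)
    (h.subset_of_nbr hB hA hiB hiA fun y hy => (hAB y hy).2)

/-- A functional that vanishes at `i` and at its neighbours in `A` vanishes on all of `A`. -/
lemma Realizes.span_eq (h : Realizes G p) {A : Finset V} (hA : IsFace p A) {i : V} (hi : i ∈ A) :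
    Submodule.span ℝ (p '' (insert i (nbr G i ∩ A) : Finset V)) =
      Submodule.span ℝ (p '' (A : Set V)) := by
  apply le_antisymm
  · refine Submodule.span_mono (Set.image_mono ?_)
    rw [Finset.coe_subset, Finset.insert_subset_iff]
    exact ⟨hi, Finset.inter_subset_right⟩
  · rw [Submodule.span_le]
    rintro _ ⟨j, hj, rfl⟩
    by_contra hnot
    obtain ⟨m, hm, hker⟩ := Submodule.exists_le_ker_of_notMem hnot
    refine hm (h.eq_zero_of_nbr hA hi m ?_ ?_ j hj)
    · exact hker (Submodule.subset_span ⟨i, by simp, rfl⟩)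
    · intro y hy ha
      exact hker (Submodule.subset_span ⟨y, by simp [hy, ha], rfl⟩)

/-- A vertex is simple if its degree is the dimension of the polytope. -/
def IsSimple (G : SimpleGraph V) (p : V → W) (i : V) : Prop :=
  (nbr G i).card + 1 = Module.finrank ℝ (Submodule.span ℝ (Set.range p))

/-- These vectors span everything, and simplicity says that there are only as many as the dimension.
-/
lemma Realizes.linearIndepOn (h : Realizes G p) {i : V} (hs : IsSimple G p i) :
    LinearIndepOn ℝ p (insert i (nbr G i) : Finset V) := by
  have h1 := h.span_eq isFace_univ (Finset.mem_univ i)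
  rw [Finset.inter_univ, Finset.coe_univ, Set.image_univ] at h1
  refine linearIndependent_iff_card_eq_finrank_span.2 ?_
  have h2 : (Set.range fun x : (insert i (nbr G i) : Finset V) => p x) =
      p '' (insert i (nbr G i) : Finset V) := by
    ext; simp
  rw [Set.finrank]
  erw [h2]
  rw [h1, ← hs]
  simp

/-- The dimension of a face can thus be read off at any simple vertex on it, which allows comparison
across realizations. -/
lemma Realizes.card_nbr_inter (h : Realizes G p) {i : V} (hs : IsSimple G p i) {A : Finset V}
    (hA : IsFace p A) (hi : i ∈ A) :
    (nbr G i ∩ A).card + 1 = Module.finrank ℝ (Submodule.span ℝ (p '' (A : Set V))) := by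
  rw [← h.span_eq hA hi, ← Finset.card_insert_of_notMem (a := i) (by simp)]
  have hli : LinearIndepOn ℝ p (insert i (nbr G i ∩ A) : Finset V) :=
    (h.linearIndepOn hs).mono (Finset.coe_subset.2
      (Finset.insert_subset_insert _ Finset.inter_subset_left))
  have h2 : (Set.range fun x : (insert i (nbr G i ∩ A) : Finset V) => p x) =
      p '' (insert i (nbr G i ∩ A) : Finset V) := by
    ext; simp
  have h3 := finrank_span_eq_card (R := ℝ) hli
  erw [h2] at h3
  rw [h3]
  simp

/-- At a simple vertex every set of neighbours spans a face. -/
lemma Realizes.exists_face_of_nbr (h : Realizes G p) {i : V} (hs : IsSimple G p i) {S : Finset V}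
    (hS : S ⊆ nbr G i) : ∃ A, IsFace p A ∧ i ∈ A ∧ nbr G i ∩ A = S := by
  classical
  have hli := h.linearIndepOn hs
  -- By linear independence there is a functional that is 0 at `i` and on `S`, and 1 at the other
  -- neighbours; local minimality at `i` makes it nonnegative everywhere.
  obtain ⟨g, hg⟩ := LinearMap.exists_extend ((Module.Basis.span hli).constr ℝ
    fun y => if y.1 = i ∨ y.1 ∈ S then (0 : ℝ) else 1)
  have hg' : ∀ y, y = i ∨ G.Adj i y → g (p y) = if y = i ∨ y ∈ S then (0 : ℝ) else 1 := by
    intro y hy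
    have hy' : y ∈ (insert i (nbr G i) : Finset V) := by simpa using hy
    have h1 := (Module.Basis.span hli).constr_basis ℝ
      (fun y => if y.1 = i ∨ y.1 ∈ S then (0 : ℝ) else 1) ⟨y, hy'⟩
    have h2 : ((Module.Basis.span hli ⟨y, hy'⟩ : Submodule.span ℝ _) : W) = p y :=
      congrArg Subtype.val (Module.Basis.span_apply hli ⟨y, hy'⟩)
    rw [← hg, LinearMap.comp_apply, Submodule.subtype_apply, h2] at h1
    exact h1
  have hgi : g (p i) = 0 := by rw [hg' i (Or.inl rfl)]; simp
  refine ⟨Finset.univ.filter fun j => g (p j) = 0, ⟨g, fun j => ?_, by simp⟩, by simp [hgi], ?_⟩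
  · refine h.nonneg_of_nbr isFace_univ (Finset.mem_univ i) g hgi (fun y _ hy => ?_) j
      (Finset.mem_univ j)
    rw [hg' y (Or.inr hy)]
    split_ifs <;> norm_num
  · ext y
    simp only [Finset.mem_inter, mem_nbr, Finset.mem_filter, Finset.mem_univ, true_and]
    constructor
    · rintro ⟨hy, h0⟩
      rw [hg' y (Or.inr hy)] at h0
      by_contra hyS
      simp [hyS, hy.ne'] at h0
    · intro hy
      have hadj : G.Adj i y := mem_nbr.1 (hS hy)
      exact ⟨hadj, by rw [hg' y (Or.inr hadj)]; simp [hy]⟩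

/-! ### Good orderings from ratios of functionals -/

lemma Realizes.le_of_nbr (h : Realizes G p) {a b : Module.Dual ℝ W} (hb : ∀ i, 0 < b (p i))
    {A : Finset V} (hA : IsFace p A) {x : V} (hx : x ∈ A)
    (hmax : ∀ y ∈ A, G.Adj x y → a (p y) / b (p y) ≤ a (p x) / b (p x)) :
    ∀ y ∈ A, a (p y) / b (p y) ≤ a (p x) / b (p x) := by
  -- Clearing the positive denominator turns the comparison of ratios into the sign of one linear
  -- functional.
  have key : ∀ y, a (p y) / b (p y) ≤ a (p x) / b (p x) ↔
      0 ≤ ((a (p x) / b (p x)) • b - a) (p y) := by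
    intro y
    simp [div_le_iff₀ (hb y)]
  intro y hy
  rw [key]
  refine h.nonneg_of_nbr hA hx _ ?_ (fun z hz hadj => (key z).1 (hmax z hz hadj)) y hy
  have := (hb x).ne'
  simp [this]

/-- A small perturbation does not change strict inequalities between ratios of functionals. -/
lemma exists_perturbation (p : V → W) {b : Module.Dual ℝ W} (a g : Module.Dual ℝ W) :
    ∃ ε : ℝ, 0 < ε ∧ ∀ i j, a (p i) / b (p i) < a (p j) / b (p j) →
      (a + ε • g) (p i) / b (p i) < (a + ε • g) (p j) / b (p j) := by
  have hev : ∀ᶠ ε in nhdsWithin (0 : ℝ) (Set.Ioi 0), ∀ i j,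
      a (p i) / b (p i) < a (p j) / b (p j) →
      (a + ε • g) (p i) / b (p i) < (a + ε • g) (p j) / b (p j) := by
    rw [Filter.eventually_all]
    intro i
    rw [Filter.eventually_all]
    intro j
    by_cases hij : a (p i) / b (p i) < a (p j) / b (p j)
    · refine Filter.Eventually.mono (nhdsWithin_le_nhds ?_) fun ε hε _ => hε
      have hc : ∀ k, Continuous fun ε : ℝ => (a + ε • g) (p k) / b (p k) := by
        intro k
        simp only [LinearMap.add_apply, LinearMap.smul_apply, smul_eq_mul]
        fun_prop
      exact (hc i).continuousAt.eventually_lt (hc j).continuousAt (by simpa using hij)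
    · exact Filter.Eventually.of_forall fun _ h => absurd h hij
  obtain ⟨ε, h1, h2⟩ := (hev.and self_mem_nhdsWithin).exists
  exact ⟨ε, h2, h1⟩

/-- Ratios at `i` and `j` agree only if `g` kills `b (p j) • p i - b (p i) • p j`. These finitely
many vectors are nonzero, so some functional avoids all their annihilators. -/
lemma Realizes.exists_generic (h : Realizes G p) {b : Module.Dual ℝ W} (hb : ∀ i, 0 < b (p i)) :
    ∃ g : Module.Dual ℝ W, Function.Injective fun i => g (p i) / b (p i) := by
  obtain ⟨g, hg⟩ := Module.exists_dual_forall_apply_ne_zero (K := ℝ)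
    (fun x : {x : V × V // x.1 ≠ x.2} => b (p x.1.2) • p x.1.1 - b (p x.1.1) • p x.1.2) (by
      rintro ⟨⟨i, j⟩, hij⟩ h0
      obtain ⟨l, hli, hl⟩ := h.exists_vertex i
      have h1 := congrArg l h0
      have h2 := mul_pos (hb i) (hl j (Ne.symm hij))
      simp only [map_sub, map_smul, hli, smul_eq_mul, map_zero] at h1
      linarith)
  refine ⟨g, fun i j hij => ?_⟩
  by_contra hne
  refine hg ⟨⟨i, j⟩, hne⟩ ?_
  rw [div_eq_div_iff (hb i).ne' (hb j).ne'] at hij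
  simp only [map_sub, map_smul, smul_eq_mul]
  linarith

/-- Refining a ratio of functionals to an injective ratio. -/
lemma Realizes.exists_refinement (h : Realizes G p) {b : Module.Dual ℝ W}
    (hb : ∀ i, 0 < b (p i)) (a : Module.Dual ℝ W) :
    ∃ a' : Module.Dual ℝ W, (Function.Injective fun i => a' (p i) / b (p i)) ∧
      ∀ i j, a (p i) / b (p i) < a (p j) / b (p j) → a' (p i) / b (p i) < a' (p j) / b (p j) := by
  obtain ⟨g, hg⟩ := h.exists_generic hb
  obtain ⟨ε, hε, hlt⟩ := exists_perturbation p (b := b) a g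
  refine ⟨a + ε • g, fun i j hij => ?_, hlt⟩
  rcases lt_trichotomy (a (p i) / b (p i)) (a (p j) / b (p j)) with h1 | h1 | h1
  · exact absurd hij (hlt i j h1).ne
  · apply hg
    simp only [LinearMap.add_apply, LinearMap.smul_apply, smul_eq_mul, add_div, h1, add_right_inj,
      mul_div_assoc, mul_right_inj' hε.ne'] at hij
    exact hij
  · exact absurd hij (hlt j i h1).ne'

/-- An ordering of the vertices is good if on every face a vertex without larger neighbours is
the largest one. -/
def IsGood (G : SimpleGraph V) (p : V → W) (f : V → ℝ) : Prop :=
  Function.Injective f ∧ ∀ A, IsFace p A → ∀ x ∈ A, (∀ y ∈ A, G.Adj x y → f y ≤ f x) →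
    ∀ y ∈ A, f y ≤ f x

/-- The ordering is by `l / b`, with `l` cutting out `F`, so that `F` comes first. The denominator
is a projective transformation that sends `w` almost to infinity: `m` vanishes only at `w`, and `δ •
e` keeps `b` positive. A small multiple of `n`, which vanishes only at `v`, puts `v` first inside
`F`, and a refinement breaks the remaining ties. -/
lemma Realizes.exists_good (h : Realizes G p) {F : Finset V} (hF : IsFace p F) (v : V) {w : V}
    (hw : w ∉ F) : ∃ f : V → ℝ, IsGood G p f ∧ (∀ x ∈ F, ∀ y, y ∉ F → f x < f y) ∧
      (∀ x, x ≠ w → f x < f w) ∧ (v ∈ F → ∀ x, x ≠ v → f v < f x) := by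
  obtain ⟨l, hl, hlF⟩ := hF
  have hlpos : ∀ x, x ∉ F → 0 < l (p x) := fun x hx =>
    lt_of_le_of_ne (hl x) fun h0 => hx ((hlF x).1 h0.symm)
  obtain ⟨e, he⟩ := h.pos
  obtain ⟨m, hmw, hm⟩ := h.exists_vertex w
  obtain ⟨n, hnv, hn⟩ := h.exists_vertex v
  -- This is `l / b` at `x` being less than at `w`, cross-multiplied; at `δ = 0` it reads `0 < l (p
  -- w) * m (p x)`.
  have hev : ∀ᶠ δ in nhdsWithin (0 : ℝ) (Set.Ioi 0), ∀ x, x ≠ w →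
      l (p x) * (δ * e (p w)) < l (p w) * (m (p x) + δ * e (p x)) := by
    rw [Filter.eventually_all]
    intro x
    by_cases hxw : x = w
    · exact Filter.Eventually.of_forall fun _ h => absurd hxw h
    · refine Filter.Eventually.mono (nhdsWithin_le_nhds ?_) fun ε hε _ => hε
      refine ContinuousAt.eventually_lt (by fun_prop) (by fun_prop) ?_
      simpa using mul_pos (hlpos w hw) (hm x hxw)
  obtain ⟨δ, hδ, hδ0⟩ := (hev.and self_mem_nhdsWithin).exists
  have hδ0 : 0 < δ := hδ0
  have hm0 : ∀ x, 0 ≤ m (p x) := fun x => by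
    by_cases hxw : x = w
    · simp [hxw, hmw]
    · exact (hm x hxw).le
  obtain ⟨b, hb⟩ : ∃ b : Module.Dual ℝ W, b = m + δ • e := ⟨_, rfl⟩
  have hb' : ∀ x, b (p x) = m (p x) + δ * e (p x) := fun x => by simp [hb]
  have hbpos : ∀ x, 0 < b (p x) := fun x => by
    rw [hb']
    exact add_pos_of_nonneg_of_pos (hm0 x) (mul_pos hδ0 (he x))
  obtain ⟨ε, hε, hlt⟩ := exists_perturbation p (b := b) l n
  obtain ⟨a, hinj, ha⟩ := h.exists_refinement hbpos (l + ε • n)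
  have ha' : ∀ i j, l (p i) / b (p i) < l (p j) / b (p j) →
    a (p i) / b (p i) < a (p j) / b (p j) := fun i j hij => ha i j (hlt i j hij)
  have hinit : ∀ x ∈ F, ∀ y, y ∉ F → a (p x) / b (p x) < a (p y) / b (p y) := by
    intro x hx y hy
    apply ha'
    rw [(hlF x).2 hx, zero_div]
    exact div_pos (hlpos y hy) (hbpos y)
  refine ⟨fun i => a (p i) / b (p i), ⟨hinj, fun A hA x hx => h.le_of_nbr hbpos hA hx⟩, hinit,
    fun x hx => ha' x w ?_, fun hv x hx => ?_⟩
  · rw [div_lt_div_iff₀ (hbpos x) (hbpos w), hb', hb', hmw, zero_add]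
    exact hδ x hx
  · by_cases hxF : x ∈ F
    · apply ha
      simp only [LinearMap.add_apply, LinearMap.smul_apply, (hlF x).2 hxF, (hlF v).2 hv, hnv,
        smul_eq_mul, mul_zero, zero_add, zero_div]
      exact div_pos (mul_pos hε (hn x hx)) (hbpos x)
    · exact hinit v hv x hxF

/-! ### Connectivity after removing a face or two vertices -/

/-- The graph induced on `A \ K` is connected. -/
def ConnectedOff (G : SimpleGraph V) (A K : Finset V) : Prop :=
  ∀ C : V → Prop, (∀ x ∈ A, ∀ y ∈ A, x ∉ K → y ∉ K → G.Adj x y → C x → C y) →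
    ∀ x ∈ A, x ∉ K → C x → ∀ y ∈ A, y ∉ K → C y

/-- All vertices of `A` in the half-space `0 ≤ g` are connected to a common vertex of `A` by paths
in this half-space that leave the hyperplane `g = 0` at once. -/
lemma Realizes.exists_common (h : Realizes G p) {A : Finset V} (hA : IsFace p A) (K : Finset V)
    (g : Module.Dual ℝ W) (hK : ∀ x ∈ K, g (p x) ≤ 0) (hpos : ∃ z ∈ A, 0 < g (p z)) :
    ∃ s ∈ A, ∀ C : V → Prop, (∀ x ∈ A, ∀ y ∈ A, x ∉ K → y ∉ K → G.Adj x y → C x → C y) →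
      ∀ x ∈ A, x ∉ K → 0 ≤ g (p x) → C x → C s := by
  classical
  obtain ⟨e, he⟩ := h.pos
  obtain ⟨a, hinj, ha⟩ := h.exists_refinement he g
  obtain ⟨z, hz, hgz⟩ := hpos
  obtain ⟨s, hs, hmax⟩ := A.exists_max_image (fun i => a (p i) / e (p i)) ⟨z, hz⟩
  refine ⟨s, hs, fun C hC x hx hxK hgx hCx => ?_⟩
  -- The highest vertex reached. It is shown to be a local, hence global, maximum of the refined
  -- ordering, so it is `s`.
  obtain ⟨y, hy, hymax⟩ := (A.filter fun y => y ∉ K ∧ 0 ≤ g (p y) ∧ C y).exists_max_image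
    (fun i => a (p i) / e (p i)) ⟨x, by simp [hx, hxK, hgx, hCx]⟩
  simp only [Finset.mem_filter] at hy hymax
  obtain ⟨hyA, hyK, hgy, hCy⟩ := hy
  have hup : ∀ t ∈ A, G.Adj y t → 0 < g (p t) → a (p t) / e (p t) ≤ a (p y) / e (p y) := by
    intro t ht hadj hgt
    have htK : t ∉ K := fun htK => (hK t htK).not_gt hgt
    exact hymax t ⟨ht, htK, hgt.le, hC y hyA t ht hyK htK hadj hCy⟩
  -- If `g` vanished at `y`, no neighbour could have positive `g`, so `y` would maximize `g` on `A`,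
  -- contrary to `z`.
  have hgy' : 0 < g (p y) := by
    refine lt_of_le_of_ne hgy fun h0 => ?_
    have h1 := h.nonneg_of_nbr hA hyA (-g) (by simp [← h0]) (fun t ht hadj => ?_) z hz
    · simp only [LinearMap.neg_apply] at h1
      linarith
    · by_contra hneg
      have hgt : 0 < g (p t) := by simpa using hneg
      refine (ha y t ?_).not_ge (hup t ht hadj hgt)
      rw [← h0, zero_div]
      exact div_pos hgt (he t)
  have hys := h.le_of_nbr he hA hyA (a := a) (fun t ht hadj => by
    by_cases hgt : 0 < g (p t)
    · exact hup t ht hadj hgt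
    · refine (ha t y ?_).le
      exact (div_nonpos_of_nonpos_of_nonneg (not_lt.1 hgt) (he t).le).trans_lt
        (div_pos hgy' (he y))) s hs
  rwa [show s = y from hinj (le_antisymm hys (hmax y hyA))]

/-- Removing a face does not disconnect the graph. -/
lemma Realizes.connectedOff_face (h : Realizes G p) {A K : Finset V} (hA : IsFace p A)
    (hK : IsFace p K) : ConnectedOff G A K := by
  intro C hC x hx hxK hCx y hy hyK
  obtain ⟨g, hg, hgK⟩ := hK
  obtain ⟨s, -, hs⟩ := h.exists_common hA K g (fun x hx => ((hgK x).2 hx).le)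
    ⟨x, hx, lt_of_le_of_ne (hg x) fun h0 => hxK ((hgK x).1 h0.symm)⟩
  by_contra hCy
  exact hs (fun x => ¬ C x) (fun a ha b hb haK hbK hab hCa hCb =>
    hCa (hC b hb a ha hbK haK hab.symm hCb)) y hy hyK (hg y) hCy (hs C hC x hx hxK (hg x) hCx)

/-- Removing two vertices does not disconnect the graph of a face of dimension at least three. -/
lemma Realizes.connectedOff_pair (h : Realizes G p) {A : Finset V} (hA : IsFace p A) {u v w : V}
    (hu : u ∈ A) (huv : u ≠ v) (huw : u ≠ w)
    (hd : 4 ≤ Module.finrank ℝ (Submodule.span ℝ (p '' (A : Set V)))) :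
    ConnectedOff G A {v, w} := by
  obtain ⟨g, hgu, hgv, hgw, hpos⟩ : ∃ g : Module.Dual ℝ W, g (p u) = 0 ∧ g (p v) = 0 ∧
      g (p w) = 0 ∧ ∃ z ∈ A, 0 < g (p z) := by
    classical
    -- Three vectors span dimension at most three, so some hyperplane contains `u`, `v` and `w` but
    -- not all of `A`.
    have hex : ∃ z ∈ A, p z ∉ Submodule.span ℝ (p '' (({u, v, w} : Finset V) : Set V)) := by
      by_contra! hcon
      have hle : Submodule.span ℝ (p '' (A : Set V)) ≤
          Submodule.span ℝ (p '' (({u, v, w} : Finset V) : Set V)) := by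
        rw [Submodule.span_le]
        rintro _ ⟨z, hz, rfl⟩
        exact hcon z hz
      rw [← Finset.coe_image (s := {u, v, w})] at hle
      have h1 := Submodule.finrank_mono hle
      have h2 := finrank_span_finset_le_card (R := ℝ) (({u, v, w} : Finset V).image p)
      have h3 := (Finset.card_image_le (s := ({u, v, w} : Finset V)) (f := p)).trans
        Finset.card_le_three
      rw [Set.finrank] at h2
      omega
    obtain ⟨z, hz, hnot⟩ := hex
    obtain ⟨m, hm, hker⟩ := Submodule.exists_le_ker_of_notMem hnot
    have hm0 : ∀ t ∈ ({u, v, w} : Finset V), m (p t) = 0 := fun t ht =>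
      hker (Submodule.subset_span ⟨t, ht, rfl⟩)
    rcases lt_or_gt_of_ne hm with hlt | hgt
    · exact ⟨-m, by simp [hm0], by simp [hm0], by simp [hm0], z, hz, by simpa using hlt⟩
    · exact ⟨m, by simp [hm0], by simp [hm0], by simp [hm0], z, hz, hgt⟩
  intro C hC x hx hxK hCx y hy hyK
  by_contra hCy
  have hC' : ∀ a ∈ A, ∀ b ∈ A, a ∉ ({v, w} : Finset V) → b ∉ ({v, w} : Finset V) → G.Adj a b →
      ¬ C a → ¬ C b := fun a ha b hb haK hbK hab hCa hCb =>
    hCa (hC b hb a ha hbK haK hab.symm hCb)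
  have hK : ∀ t ∈ ({v, w} : Finset V), g (p t) = 0 := by simp [hgv, hgw]
  have huK : u ∉ ({v, w} : Finset V) := by simp [huv, huw]
  obtain ⟨s, -, hs⟩ := h.exists_common hA {v, w} g (fun t ht => (hK t ht).le) hpos
  -- The vertex `u` is not removed and lies in both closed half-spaces, so it links their tops `s`
  -- and `r`.
  by_cases hneg : ∃ z ∈ A, 0 < (-g) (p z)
  · obtain ⟨r, -, hr⟩ := h.exists_common hA {v, w} (-g) (fun t ht => by simp [hK t ht]) hneg
    have hreach : ∀ D : V → Prop, (∀ a ∈ A, ∀ b ∈ A, a ∉ ({v, w} : Finset V) →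
        b ∉ ({v, w} : Finset V) → G.Adj a b → D a → D b) → ∀ t ∈ A, t ∉ ({v, w} : Finset V) →
        D t → D s ∨ D r := by
      intro D hD t ht htK hDt
      rcases le_total 0 (g (p t)) with h0 | h0
      · exact Or.inl (hs D hD t ht htK h0 hDt)
      · exact Or.inr (hr D hD t ht htK (by simpa using h0) hDt)
    by_cases hCu : C u
    · have h1 := hs C hC u hu huK hgu.ge hCu
      have h2 := hr C hC u hu huK (by simp [hgu]) hCu
      rcases hreach _ hC' y hy hyK hCy with h3 | h3
      · exact h3 h1
      · exact h3 h2
    · have h1 := hs _ hC' u hu huK hgu.ge hCu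
      have h2 := hr _ hC' u hu huK (by simp [hgu]) hCu
      rcases hreach C hC x hx hxK hCx with h3 | h3
      · exact h1 h3
      · exact h2 h3
  · have hnn : ∀ z ∈ A, 0 ≤ g (p z) := by
      intro z hz
      by_contra hz'
      exact hneg ⟨z, hz, by simpa using hz'⟩
    exact hs _ hC' y hy hyK (hnn y hy) hCy (hs C hC x hx hxK (hnn x hx) hCx)

end Config
-- Kalai's count of local maxima
section Count

variable {V W : Type*} [Fintype V] [DecidableEq V] [AddCommGroup W] [Module ℝ W]
  {G : SimpleGraph V} {p : V → W}

/-- No neighbour of `x` in `A` is larger than `x`. -/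
def IsLocalMaxOn (G : SimpleGraph V) (f : V → ℝ) (A : Finset V) (x : V) : Prop :=
  ∀ y ∈ A, G.Adj x y → f y ≤ f x

open scoped Classical in
/-- The nonempty faces that do not contain `w`. -/
noncomputable def facesOff (p : V → W) (w : V) : Finset (Finset V) :=
  Finset.univ.filter fun A => IsFace p A ∧ A.Nonempty ∧ w ∉ A

open scoped Classical in
/-- The pairs of a vertex `x` and a face on which `x` is a local maximum, where `x ≠ w`, and the
face does not contain `w` if `x = v`. -/
noncomputable def peaks (G : SimpleGraph V) (p : V → W) (f : V → ℝ) (v w : V) :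
    Finset (V × Finset V) :=
  Finset.univ.filter fun a => (IsFace p a.2 ∧ a.1 ∈ a.2 ∧ IsLocalMaxOn G f a.2 a.1) ∧
    a.1 ≠ w ∧ ¬ (a.1 = v ∧ w ∈ a.2)

lemma mem_facesOff {w : V} {A : Finset V} :
    A ∈ facesOff p w ↔ IsFace p A ∧ A.Nonempty ∧ w ∉ A := by simp [facesOff]

lemma mem_peaks {f : V → ℝ} {v w x : V} {A : Finset V} :
    (x, A) ∈ peaks G p f v w ↔ (IsFace p A ∧ x ∈ A ∧ IsLocalMaxOn G f A x) ∧
      x ≠ w ∧ ¬ (x = v ∧ w ∈ A) := by simp [peaks]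

lemma exists_mem_peaks (f : V → ℝ) (v : V) {w : V} {A : Finset V} (hA : A ∈ facesOff p w) :
    ∃ x ∈ A, (x, A) ∈ peaks G p f v w ∧ ∀ y ∈ A, f y ≤ f x := by
  rw [mem_facesOff] at hA
  obtain ⟨hA, hne, hw⟩ := hA
  obtain ⟨x, hx, hmax⟩ := A.exists_max_image f hne
  exact ⟨x, hx, mem_peaks.2 ⟨⟨hA, hx, fun y hy _ => hmax y hy⟩, fun h => hw (h ▸ hx),
    fun h => hw h.2⟩, hmax⟩

lemma facesOff_subset (f : V → ℝ) (v w : V) :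
    facesOff p w ⊆ (peaks G p f v w).image Prod.snd := by
  intro A hA
  obtain ⟨x, -, hx, -⟩ := exists_mem_peaks (G := G) f v hA
  exact Finset.mem_image_of_mem Prod.snd hx

lemma card_facesOff_le (f : V → ℝ) (v w : V) :
    (facesOff p w).card ≤ (peaks G p f v w).card :=
  (Finset.card_le_card (facesOff_subset f v w)).trans Finset.card_image_le

/-- In a good ordering with `w` last, a face through `w` has its only local maximum at `w`, which is
not counted, and any other nonempty face has exactly one. -/
lemma IsGood.card_peaks_le {f : V → ℝ} (hf : IsGood G p f) {w : V}
    (hw : ∀ x, x ≠ w → f x < f w) (v : V) :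
    (peaks G p f v w).card ≤ (facesOff p w).card := by
  refine Finset.card_le_card_of_injOn Prod.snd ?_ ?_
  · rintro ⟨x, A⟩ hxA
    obtain ⟨⟨hA, hx, hmax⟩, hxw, -⟩ := mem_peaks.1 hxA
    exact mem_facesOff.2 ⟨hA, ⟨x, hx⟩, fun hwA => (hf.2 A hA x hx hmax w hwA).not_gt (hw x hxw)⟩
  · rintro ⟨x, A⟩ hxA ⟨y, B⟩ hyB (rfl : A = B)
    obtain ⟨⟨hA, hx, hxmax⟩, -⟩ := mem_peaks.1 hxA
    obtain ⟨⟨-, hy, hymax⟩, -⟩ := mem_peaks.1 hyB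
    rw [hf.1 (le_antisymm (hf.2 A hA y hy hymax x hx) (hf.2 A hA x hx hxmax y hy))]

/-- Each face off `w` already has a peak at its global maximum, so the bound on the count leaves
room for no other peak. -/
lemma max_of_card_peaks_le {f : V → ℝ} {v w : V}
    (hle : (peaks G p f v w).card ≤ (facesOff p w).card) {x : V} {A : Finset V}
    (hxA : (x, A) ∈ peaks G p f v w) : w ∉ A ∧ ∀ y ∈ A, f y ≤ f x := by
  have heq := Finset.eq_of_subset_of_card_le (facesOff_subset (G := G) (p := p) f v w)
    (Finset.card_image_le.trans hle)
  have hinj : Set.InjOn Prod.snd (peaks G p f v w : Set (V × Finset V)) := by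
    rw [← Finset.card_image_iff]
    refine le_antisymm Finset.card_image_le ?_
    rwa [← heq]
  have hA : A ∈ facesOff p w := heq ▸ Finset.mem_image_of_mem Prod.snd hxA
  obtain ⟨z, -, hz, hmax⟩ := exists_mem_peaks (G := G) f v hA
  have hxz : x = z := congrArg Prod.fst (hinj hxA hz rfl)
  exact ⟨(mem_facesOff.1 hA).2.2, hxz ▸ hmax⟩

open scoped Classical in
-- Faces through a simple vertex correspond to sets of its neighbours, and `x` is a local maximum
-- when these are all smaller. So the count depends only on `G` and `f`.
lemma Realizes.card_localMax (h : Realizes G p) (f : V → ℝ) {x : V} (hs : IsSimple G p x) :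
    (Finset.univ.filter fun A => IsFace p A ∧ x ∈ A ∧ IsLocalMaxOn G f A x).card =
      ((nbr G x).filter fun y => f y ≤ f x).powerset.card := by
  refine Finset.card_bij (fun A _ => nbr G x ∩ A) ?_ ?_ ?_
  · intro A hA
    obtain ⟨-, -, hmax⟩ := (Finset.mem_filter.1 hA).2
    rw [Finset.mem_powerset]
    intro y hy
    rw [Finset.mem_inter, mem_nbr] at hy
    simp [hy.1, hmax y hy.2 hy.1]
  · intro A hA B hB hAB
    obtain ⟨hA, hxA, -⟩ := (Finset.mem_filter.1 hA).2
    obtain ⟨hB, hxB, -⟩ := (Finset.mem_filter.1 hB).2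
    refine h.eq_of_nbr hA hB hxA hxB fun y hy => ?_
    simpa [hy] using Finset.ext_iff.1 hAB y
  · intro S hS
    rw [Finset.mem_powerset] at hS
    obtain ⟨A, hA, hxA, rfl⟩ := h.exists_face_of_nbr hs (hS.trans (Finset.filter_subset _ _))
    refine ⟨A, ?_, rfl⟩
    simp only [Finset.mem_filter, Finset.mem_univ, true_and]
    refine ⟨hA, hxA, fun y hy hadj => ?_⟩
    exact (Finset.mem_filter.1 (hS (by simp [hadj, hy]))).2

open scoped Classical in
lemma Realizes.card_peaks_fiber (h : Realizes G p) (f : V → ℝ) {v w x : V} (hxv : x ≠ v)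
    (hxw : x ≠ w) (hs : IsSimple G p x) :
    ((peaks G p f v w).filter fun a => a.1 = x).card =
      ((nbr G x).filter fun y => f y ≤ f x).powerset.card := by
  rw [← h.card_localMax f hs]
  refine Finset.card_bij (fun a _ => a.2) ?_ ?_ ?_
  · rintro ⟨y, A⟩ hy
    obtain ⟨hy', rfl⟩ := Finset.mem_filter.1 hy
    simpa using (mem_peaks.1 hy').1
  · rintro ⟨y, A⟩ hy ⟨z, B⟩ hz (rfl : A = B)
    obtain ⟨-, rfl⟩ := Finset.mem_filter.1 hy
    obtain ⟨-, hz'⟩ := Finset.mem_filter.1 hz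
    exact Prod.ext hz'.symm rfl
  · intro A hA
    simp only [Finset.mem_filter, Finset.mem_univ, true_and] at hA
    exact ⟨(x, A), by simp [mem_peaks, hA, hxw, hxv], rfl⟩

end Count

/-! ### Two realizations: faces that miss one of the exceptional vertices -/

section Pair

variable {V W W' : Type*} [Fintype V] [DecidableEq V] [AddCommGroup W] [Module ℝ W]
  [AddCommGroup W'] [Module ℝ W'] {G : SimpleGraph V} {p : V → W} {q : V → W'} {v w : V}

/-- Two realizations of the same graph in which all vertices except `v` and `w` are simple. -/
structure AlmostSimplePair (G : SimpleGraph V) (p : V → W) (q : V → W') (v w : V) : Prop where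
  fst : Realizes G p
  snd : Realizes G q
  ne : v ≠ w
  simple_fst : ∀ x, x ≠ v → x ≠ w → IsSimple G p x
  simple_snd : ∀ x, x ≠ v → x ≠ w → IsSimple G q x

lemma AlmostSimplePair.symm (h : AlmostSimplePair G p q v w) : AlmostSimplePair G q p v w :=
  ⟨h.snd, h.fst, h.ne, h.simple_snd, h.simple_fst⟩

lemma AlmostSimplePair.swap (h : AlmostSimplePair G p q v w) : AlmostSimplePair G p q w v :=
  ⟨h.fst, h.snd, h.ne.symm, fun x h1 h2 => h.simple_fst x h2 h1,
    fun x h1 h2 => h.simple_snd x h2 h1⟩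

open scoped Classical in
-- Compare fibres over `x`: none at `w`, equal ones at `v` by `hT`, and at simple vertices a number
-- given by the graph.
lemma AlmostSimplePair.card_peaks (h : AlmostSimplePair G p q v w) (f : V → ℝ)
    (hT : ∀ A, v ∈ A → w ∉ A → IsLocalMaxOn G f A v → (IsFace p A ↔ IsFace q A)) :
    (peaks G p f v w).card = (peaks G q f v w).card := by
  rw [Finset.card_eq_sum_card_fiberwise (f := Prod.fst) (t := Finset.univ)
      (fun _ _ => Finset.mem_coe.2 (Finset.mem_univ _)),
    Finset.card_eq_sum_card_fiberwise (f := Prod.fst) (s := peaks G q f v w) (t := Finset.univ)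
      (fun _ _ => Finset.mem_coe.2 (Finset.mem_univ _))]
  refine Finset.sum_congr rfl fun x _ => ?_
  by_cases hxw : x = w
  · rw [Finset.filter_eq_empty_iff.2, Finset.filter_eq_empty_iff.2] <;>
    · rintro ⟨y, A⟩ hy rfl
      exact (mem_peaks.1 hy).2.1 hxw
  by_cases hxv : x = v
  · congr 1
    ext ⟨y, A⟩
    simp only [Finset.mem_filter, mem_peaks]
    have := hT A
    constructor <;>
    · rintro ⟨⟨⟨h1, h2, h3⟩, h4, h5⟩, rfl⟩
      subst hxv
      have h6 : w ∉ A := fun hw => h5 ⟨rfl, hw⟩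
      have h7 := this h2 h6 h3
      tauto
  · rw [h.fst.card_peaks_fiber f hxv hxw (h.simple_fst x hxv hxw),
      h.snd.card_peaks_fiber f hxv hxw (h.simple_snd x hxv hxw)]

/-- If `f` is good for `p`, then it satisfies the conclusion of goodness for `q` at all peaks. -/
lemma AlmostSimplePair.max_of_isGood (h : AlmostSimplePair G p q v w) {f : V → ℝ}
    (hf : IsGood G p f) (hw : ∀ x, x ≠ w → f x < f w)
    (hT : ∀ A, v ∈ A → w ∉ A → IsLocalMaxOn G f A v → (IsFace p A ↔ IsFace q A))
    (hle : (facesOff p w).card ≤ (facesOff q w).card) {x : V} {A : Finset V}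
    (hxA : (x, A) ∈ peaks G q f v w) : w ∉ A ∧ ∀ y ∈ A, f y ≤ f x := by
  refine max_of_card_peaks_le ?_ hxA
  rw [← h.card_peaks f hT]
  exact (hf.card_peaks_le hw v).trans hle

/-- If `v` is the smallest vertex, it is a local maximum only on the face `{v}`. -/
lemma Realizes.eq_singleton_of_localMax (h : Realizes G p) {f : V → ℝ}
    (hv : ∀ x, x ≠ v → f v < f x) {A : Finset V} (hA : IsFace p A) (hvA : v ∈ A)
    (hmax : IsLocalMaxOn G f A v) : A = {v} := by
  by_contra hne
  obtain ⟨j, hj, hjv⟩ : ∃ j ∈ A, j ≠ v := by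
    by_contra! hcon
    exact hne (Finset.eq_singleton_iff_unique_mem.2 ⟨hvA, hcon⟩)
  obtain ⟨y, hy, hadj⟩ := h.exists_edge A hA hvA ⟨j, hj, hjv⟩
  exact (hmax y hy hadj).not_gt (hv y hadj.ne')

lemma AlmostSimplePair.isFace_iff_of_first (h : AlmostSimplePair G p q v w) {f : V → ℝ}
    (hv : ∀ x, x ≠ v → f v < f x) {A : Finset V} (hvA : v ∈ A) (hmax : IsLocalMaxOn G f A v) :
    IsFace p A ↔ IsFace q A := by
  constructor
  · intro hA
    rw [h.fst.eq_singleton_of_localMax hv hA hvA hmax]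
    exact h.snd.vertex v
  · intro hA
    rw [h.snd.eq_singleton_of_localMax hv hA hvA hmax]
    exact h.fst.vertex v

lemma AlmostSimplePair.card_facesOff_le (h : AlmostSimplePair G p q v w) :
    (facesOff q w).card ≤ (facesOff p w).card := by
  obtain ⟨f, hf, -, hw, hv⟩ := h.fst.exists_good (h.fst.vertex v) v (w := w) (by simp [h.ne.symm])
  refine (CubeSlice.card_facesOff_le (G := G) f v w).trans ?_
  rw [← h.card_peaks f fun A hvA _ hmax => h.isFace_iff_of_first (hv (by simp)) hvA hmax]
  exact hf.card_peaks_le hw v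

/-- Equal degrees at the simple vertex `x` mean equal dimensions, which give equal degrees at the
simple vertex `z`. -/
lemma AlmostSimplePair.card_nbr_inter (h : AlmostSimplePair G p q v w) {A B : Finset V}
    (hA : IsFace p A) (hB : IsFace q B) {x z : V} (hxv : x ≠ v) (hxw : x ≠ w) (hxA : x ∈ A)
    (hxB : x ∈ B) (hx : nbr G x ∩ A = nbr G x ∩ B) (hzv : z ≠ v) (hzw : z ≠ w) (hzA : z ∈ A)
    (hzB : z ∈ B) : (nbr G z ∩ A).card = (nbr G z ∩ B).card := by
  have h1 := h.fst.card_nbr_inter (h.simple_fst x hxv hxw) hA hxA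
  have h2 := h.fst.card_nbr_inter (h.simple_fst z hzv hzw) hA hzA
  have h3 := h.snd.card_nbr_inter (h.simple_snd x hxv hxw) hB hxB
  have h4 := h.snd.card_nbr_inter (h.simple_snd z hzv hzw) hB hzB
  rw [hx] at h1
  omega

lemma mem_of_nbr_inter_eq {A B : Finset V} {x y : V} (h : nbr G x ∩ A = nbr G x ∩ B)
    (hadj : G.Adj x y) : y ∈ A ↔ y ∈ B := by
  simpa [hadj] using Finset.ext_iff.1 h y

/-- By equality of degrees, `A` and `B` have the same edges at each vertex of `B` other than `v`.
Hence `B` absorbs the connected graph on `A` without `v`, and finally `v` along an edge. -/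
lemma AlmostSimplePair.eq_of_subset (h : AlmostSimplePair G p q v w) {A B : Finset V}
    (hA : IsFace p A) (hB : IsFace q B) (hBA : B ⊆ A) (hwA : w ∉ A) {x : V} (hxv : x ≠ v)
    (hxB : x ∈ B) (hx : nbr G x ∩ A = nbr G x ∩ B) : A = B := by
  have hne : ∀ y ∈ A, y ≠ w := fun y hy hyw => hwA (hyw ▸ hy)
  have hnbr : ∀ z ∈ B, z ≠ v → nbr G z ∩ A = nbr G z ∩ B := by
    intro z hz hzv
    refine (Finset.eq_of_subset_of_card_le (Finset.inter_subset_inter_left hBA) ?_).symm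
    exact (h.card_nbr_inter hA hB hxv (hne x (hBA hxB)) (hBA hxB) hxB hx hzv (hne z (hBA hz))
      (hBA hz) hz).le
  refine Finset.Subset.antisymm (fun y hy => ?_) hBA
  have hcon := h.fst.connectedOff_face hA (h.fst.vertex v) (· ∈ B) (fun a _ b hb hav _ hab haB =>
    (mem_of_nbr_inter_eq (hnbr a haB (by simpa using hav)) hab).1 hb) x (hBA hxB)
    (by simpa using hxv) hxB
  by_cases hyv : y = v
  · obtain ⟨z, hz, hadj⟩ := h.fst.exists_edge A hA hy ⟨x, hBA hxB, by rwa [hyv]⟩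
    have hzv : z ≠ v := fun hzv => hadj.ne (hyv.trans hzv.symm)
    exact (mem_of_nbr_inter_eq (hnbr z (hcon z hz (by simpa using hzv)) hzv) hadj.symm).1 hy
  · exact hcon y hy (by simpa using hyv)

lemma Realizes.isFace_empty (h : Realizes G p) : IsFace p ∅ := by
  obtain ⟨e, he⟩ := h.pos
  exact ⟨e, fun i => (he i).le, fun i => by simp [(he i).ne']⟩

/-- Let `x` be the top of `F` in an ordering good for `p` with `F` initial. The face of `q` with the
same edges at `x` has a peak there, so `x` is its maximum, so it lies in `F` and equals `F`. The
count needs agreement on faces topped by `v`: this is automatic if `v ∈ F`, as `v` is then first,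
and otherwise comes from the faces through `v`, treated beforehand. -/
lemma AlmostSimplePair.isFace_of_notMem (h : AlmostSimplePair G p q v w) {F : Finset V}
    (hF : IsFace p F) (hwF : w ∉ F)
    (hvF : v ∈ F ∨ ∀ A, v ∈ A → w ∉ A → (IsFace p A ↔ IsFace q A)) : IsFace q F := by
  rcases F.eq_empty_or_nonempty with rfl | hne
  · exact h.snd.isFace_empty
  obtain ⟨f, hf, hinit, hlast, hfirst⟩ := h.fst.exists_good hF v hwF
  obtain ⟨x, hx, hmax⟩ := F.exists_max_image f hne
  have hxw : x ≠ w := fun hxw => hwF (hxw ▸ hx)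
  by_cases hxv : x = v
  · have : F = {v} := by
      refine Finset.eq_singleton_iff_unique_mem.2 ⟨hxv ▸ hx, fun y hy => ?_⟩
      by_contra hyv
      exact (hmax y hy).not_gt (hxv ▸ hfirst (hxv ▸ hx) y hyv)
    rw [this]
    exact h.snd.vertex v
  obtain ⟨B, hB, hxB, hnbr⟩ := h.snd.exists_face_of_nbr (h.simple_snd x hxv hxw)
    (Finset.inter_subset_left (s₁ := nbr G x) (s₂ := F))
  have hpeak : (x, B) ∈ peaks G q f v w := by
    refine mem_peaks.2 ⟨⟨hB, hxB, fun y hy hadj => ?_⟩, hxw, fun h => hxv h.1⟩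
    exact hmax y ((mem_of_nbr_inter_eq hnbr hadj).1 hy)
  have hB' := (h.max_of_isGood hf hlast (fun A hvA hwA hAmax => ?_) h.symm.card_facesOff_le hpeak).2
  · have hBF : B ⊆ F := fun y hy => by
      by_contra hyF
      exact (hB' y hy).not_gt (hinit x hx y hyF)
    rwa [h.eq_of_subset hF hB hBF hwF hxv hxB hnbr.symm]
  · rcases hvF with hvF | hvF
    · exact h.isFace_iff_of_first (hfirst hvF) hvA hAmax
    · exact hvF A hvA hwA

lemma AlmostSimplePair.isFace_iff_of_mem (h : AlmostSimplePair G p q v w) {F : Finset V}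
    (hvF : v ∈ F) (hwF : w ∉ F) : IsFace p F ↔ IsFace q F :=
  ⟨fun hF => h.isFace_of_notMem hF hwF (Or.inl hvF),
    fun hF => h.symm.isFace_of_notMem hF hwF (Or.inl hvF)⟩

/-- The faces that do not contain both `v` and `w` agree. -/
lemma AlmostSimplePair.isFace_of_not_both (h : AlmostSimplePair G p q v w) {F : Finset V}
    (hF : IsFace p F) (hvw : ¬ (v ∈ F ∧ w ∈ F)) : IsFace q F := by
  by_cases hv : v ∈ F
  · exact (h.isFace_iff_of_mem hv fun hw => hvw ⟨hv, hw⟩).1 hF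
  by_cases hw : w ∈ F
  · exact (h.swap.isFace_iff_of_mem hw hv).1 hF
  · exact h.isFace_of_notMem hF hw (Or.inr fun A hvA hwA => h.isFace_iff_of_mem hvA hwA)

/-! ### Faces through both exceptional vertices -/

/-- Faces of `p` and `q` through a simple vertex `x` with the same edges there have the same edges
at every simple neighbour. -/
lemma AlmostSimplePair.nbr_inter_eq_of_adj (h : AlmostSimplePair G p q v w) {A B : Finset V}
    (hA : IsFace p A) (hB : IsFace q B) (hvA : v ∈ A) {x z : V} (hxv : x ≠ v) (hxw : x ≠ w)
    (hxA : x ∈ A) (hxB : x ∈ B) (hx : nbr G x ∩ A = nbr G x ∩ B) (hzv : z ≠ v) (hzw : z ≠ w)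
    (hzA : z ∈ A) (hadj : G.Adj x z) : z ∈ B ∧ nbr G z ∩ A = nbr G z ∩ B := by
  have hzB : z ∈ B := (mem_of_nbr_inter_eq hx hadj).1 hzA
  refine ⟨hzB, (Finset.eq_of_subset_of_card_le ?_
    (h.card_nbr_inter hA hB hxv hxw hxA hxB hx hzv hzw hzA hzB).le).symm⟩
  intro a ha
  rw [Finset.mem_inter, mem_nbr] at ha ⊢
  obtain ⟨hza, haB⟩ := ha
  refine ⟨hza, by_contra fun haA => ?_⟩
  -- The 2-face spanned by the edges `zx` and `za` meets `A` only in the edge `zx`, so it misses `v`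
  -- and is common to both realizations. It then lies in `B`, and comparing edges at `x` puts it in
  -- `A`, a contradiction.
  obtain ⟨T, hT, hzT, hnT⟩ := h.fst.exists_face_of_nbr (h.simple_fst z hzv hzw) (S := {x, a})
    (by simp [Finset.insert_subset_iff, hza, hadj.symm])
  have hmem : ∀ y, G.Adj z y → (y ∈ T ↔ y = x ∨ y = a) := fun y hy => by
    simpa [hy] using Finset.ext_iff.1 hnT y
  have hxT : x ∈ T := (hmem x hadj.symm).2 (Or.inl rfl)
  have haT : a ∈ T := (hmem a hza).2 (Or.inr rfl)
  have hTA : T ∩ A = {z, x} := by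
    refine h.fst.eq_of_nbr (hT.inter hA) ((h.fst.adj_iff z x).1 hadj.symm).2 (i := z)
      (by simp [hzT, hzA]) (by simp) fun y hy => ?_
    simp only [Finset.mem_inter, hmem y hy, Finset.mem_insert, Finset.mem_singleton]
    constructor
    · rintro ⟨rfl | rfl, hyA⟩
      · exact Or.inr rfl
      · exact absurd hyA haA
    · rintro (rfl | rfl)
      · exact absurd rfl hy.ne
      · exact ⟨Or.inl rfl, hxA⟩
  have hvT : v ∉ T := fun hvT => by
    have : v ∈ T ∩ A := Finset.mem_inter.2 ⟨hvT, hvA⟩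
    rw [hTA, Finset.mem_insert, Finset.mem_singleton] at this
    rcases this with h1 | h1
    · exact hzv h1.symm
    · exact hxv h1.symm
  have hTq := h.isFace_of_not_both hT fun hvw => hvT hvw.1
  have hTB : T ⊆ B := h.snd.subset_of_nbr hTq hB hzT hzB fun y hy hyT => by
    rcases (hmem y hy).1 hyT with rfl | rfl
    · exact hxB
    · exact haB
  have hTA' : T ⊆ A := h.fst.subset_of_nbr hT hA hxT hxA fun y hy hyT =>
    (mem_of_nbr_inter_eq hx hy).2 (hTB hyT)
  exact haA (hTA' haT)

lemma AlmostSimplePair.subset_of_connectedOff (h : AlmostSimplePair G p q v w) {A B : Finset V}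
    (hA : IsFace p A) (hB : IsFace q B) (hvA : v ∈ A) (hvB : v ∈ B) (hwB : w ∈ B)
    {x : V} (hxv : x ≠ v) (hxw : x ≠ w) (hxA : x ∈ A) (hxB : x ∈ B)
    (hx : nbr G x ∩ A = nbr G x ∩ B) (hcon : ConnectedOff G A {v, w}) : A ⊆ B := by
  intro y hy
  by_cases hyv : y = v
  · rwa [hyv]
  by_cases hyw : y = w
  · rwa [hyw]
  refine (hcon (fun z => z ∈ B ∧ nbr G z ∩ A = nbr G z ∩ B) ?_ x hxA (by simp [hxv, hxw])
    ⟨hxB, hx⟩ y hy (by simp [hyv, hyw])).1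
  rintro a haA b hbA ha hb hab ⟨haB, hnbr⟩
  simp only [Finset.mem_insert, Finset.mem_singleton, not_or] at ha hb
  exact h.nbr_inter_eq_of_adj hA hB hvA ha.1 ha.2 haA haB hnbr hb.1 hb.2 hbA hab

/-- A face of dimension at most two is determined by any two nonadjacent vertices on it. -/
lemma AlmostSimplePair.eq_of_finrank_le (h : AlmostSimplePair G p q v w) {A B : Finset V}
    (hA : IsFace p A) (hB : IsFace p B) (hvA : v ∈ A) (hwA : w ∈ A) (hvB : v ∈ B) (hwB : w ∈ B)
    (hvw : ¬ G.Adj v w) (hr : Module.finrank ℝ (Submodule.span ℝ (p '' (A : Set V))) ≤ 3) :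
    A ∩ B = A := by
  have hAB := hA.inter hB
  have hv : v ∈ A ∩ B := Finset.mem_inter.2 ⟨hvA, hvB⟩
  have hw : w ∈ A ∩ B := Finset.mem_inter.2 ⟨hwA, hwB⟩
  obtain ⟨y, hy, hadj⟩ := h.fst.exists_edge _ hAB hv ⟨w, hw, h.ne.symm⟩
  have hyw : y ≠ w := fun hyw => hvw (hyw ▸ hadj)
  have hyA := (Finset.mem_inter.1 hy).1
  have hs := h.simple_fst y hadj.ne' hyw
  have h1 := h.fst.card_nbr_inter hs hA hyA
  -- With a single edge at `y`, the face `A ∩ B` would be the edge `vy`, which misses `w`. Since `A`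
  -- has at most two edges at `y`, both faces have the same ones.
  have h2 : 1 < (nbr G y ∩ (A ∩ B)).card := by
    by_contra hle
    rw [not_lt, Finset.card_le_one] at hle
    have hsub := h.fst.subset_of_nbr hAB ((h.fst.adj_iff v y).1 hadj).2 hy (by simp)
      fun z hz hzAB => by
        have := hle z (by simpa [hz] using hzAB) v (by simpa [hadj.symm] using hv)
        simp [this]
    have := hsub hw
    simp only [Finset.mem_insert, Finset.mem_singleton] at this
    rcases this with h3 | h3
    · exact h.ne h3.symm
    · exact hyw h3.symm
  have h3 : nbr G y ∩ (A ∩ B) = nbr G y ∩ A :=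
    Finset.eq_of_subset_of_card_le (Finset.inter_subset_inter_left Finset.inter_subset_left)
      (by omega)
  exact h.fst.eq_of_nbr hAB hA hy hyA fun z hz => mem_of_nbr_inter_eq h3 hz

lemma AlmostSimplePair.subset_of_both (h : AlmostSimplePair G p q v w) {A B : Finset V}
    (hA : IsFace p A) (hB : IsFace q B) (hvA : v ∈ A) (hwA : w ∈ A) (hvB : v ∈ B) (hwB : w ∈ B)
    {x : V} (hxv : x ≠ v) (hxw : x ≠ w) (hxA : x ∈ A) (hxB : x ∈ B)
    (hx : nbr G x ∩ A = nbr G x ∩ B) : A ⊆ B := by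
  by_cases hvw : G.Adj v w
  · exact h.subset_of_connectedOff hA hB hvA hvB hwB hxv hxw hxA hxB hx
      (h.fst.connectedOff_face hA ((h.fst.adj_iff v w).1 hvw).2)
  by_cases hr : 4 ≤ Module.finrank ℝ (Submodule.span ℝ (p '' (A : Set V)))
  · exact h.subset_of_connectedOff hA hB hvA hvB hwB hxv hxw hxA hxB hx
      (h.fst.connectedOff_pair hA hxA hxv hxw hr)
  -- Here `A` has dimension at most two and `v`, `w` are not adjacent, so deleting them may
  -- disconnect it. Instead, for each `z`, the face of `q` with the edges of `A` at `z` contains `v`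
  -- and `w`, and so lies in `B`.
  intro z hz
  by_cases hzv : z = v
  · rwa [hzv]
  by_cases hzw : z = w
  · rwa [hzw]
  obtain ⟨C, hC, hzC, hnC⟩ := h.snd.exists_face_of_nbr (h.simple_snd z hzv hzw)
    (Finset.inter_subset_left (s₁ := nbr G z) (s₂ := A))
  have hvwC : v ∈ C ∧ w ∈ C := by
    by_contra hcon
    have hC' := h.symm.isFace_of_not_both hC hcon
    have : C = A := h.fst.eq_of_nbr hC' hA hzC hz fun y hy => mem_of_nbr_inter_eq hnC hy
    exact hcon ⟨this ▸ hvA, this ▸ hwA⟩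
  have hrB : Module.finrank ℝ (Submodule.span ℝ (q '' (B : Set V))) ≤ 3 := by
    rw [← h.snd.card_nbr_inter (h.simple_snd x hxv hxw) hB hxB, ← hx,
      h.fst.card_nbr_inter (h.simple_fst x hxv hxw) hA hxA]
    omega
  have hrC : Module.finrank ℝ (Submodule.span ℝ (q '' (C : Set V))) ≤ 3 := by
    rw [← h.snd.card_nbr_inter (h.simple_snd z hzv hzw) hC hzC, hnC,
      h.fst.card_nbr_inter (h.simple_fst z hzv hzw) hA hz]
    omega
  have h1 := h.symm.eq_of_finrank_le hC hB hvwC.1 hvwC.2 hvB hwB hvw hrC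
  exact (Finset.mem_inter.1 (h1.symm ▸ hzC : z ∈ C ∩ B)).2

lemma AlmostSimplePair.isFace_of_isFace (h : AlmostSimplePair G p q v w) {F : Finset V}
    (hF : IsFace p F) : IsFace q F := by
  by_cases hvw : v ∈ F ∧ w ∈ F
  swap
  · exact h.isFace_of_not_both hF hvw
  obtain ⟨hv, hw⟩ := hvw
  by_cases hF2 : F = {v, w}
  · rw [hF2] at hF ⊢
    exact ((h.snd.adj_iff v w).1 ((h.fst.adj_iff v w).2 ⟨h.ne, hF⟩)).2
  obtain ⟨x, hx, hxv, hxw⟩ : ∃ x ∈ F, x ≠ v ∧ x ≠ w := by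
    by_contra! hcon
    refine hF2 (Finset.Subset.antisymm (fun z hz => ?_) (by simp [Finset.insert_subset_iff, hv, hw]))
    by_cases hzv : z = v
    · simp [hzv]
    · simp [hcon z hz hzv]
  obtain ⟨B, hB, hxB, hnB⟩ := h.snd.exists_face_of_nbr (h.simple_snd x hxv hxw)
    (Finset.inter_subset_left (s₁ := nbr G x) (s₂ := F))
  -- Otherwise `B` would be a face of `p` too, with the same edges at `x` as `F`, hence equal to
  -- `F`.
  have hvwB : v ∈ B ∧ w ∈ B := by
    by_contra hcon
    have hB' := h.symm.isFace_of_not_both hB hcon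
    have : B = F := h.fst.eq_of_nbr hB' hF hxB hx fun y hy => mem_of_nbr_inter_eq hnB hy
    exact hcon ⟨this ▸ hv, this ▸ hw⟩
  have h1 := h.subset_of_both hF hB hv hw hvwB.1 hvwB.2 hxv hxw hx hxB hnB.symm
  have h2 := h.symm.subset_of_both hB hF hvwB.1 hvwB.2 hv hw hxv hxw hxB hx hnB
  rwa [Finset.Subset.antisymm h1 h2]

/-- The graph of a polytope with at most two nonsimple vertices determines its faces. -/
theorem AlmostSimplePair.isFace_iff (h : AlmostSimplePair G p q v w) (F : Finset V) :
    IsFace p F ↔ IsFace q F :=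
  ⟨h.isFace_of_isFace, h.symm.isFace_of_isFace⟩

end Pair
-- From polytopes to cones
section Polytope

variable {n : ℕ} {P : Set (Fin n → ℝ)}

lemma eq_convexHull_extremePoints {F : Set (Fin n → ℝ)} (hc : IsCompact F) (hconv : Convex ℝ F)
    (hfin : (F.extremePoints ℝ).Finite) : F = convexHull ℝ (F.extremePoints ℝ) := by
  conv_lhs => rw [← closure_convexHull_extremePoints hc hconv]
  exact (hfin.isClosed_convexHull ℝ).closure_eq

lemma IsPolytope.isCompact (hP : IsPolytope P) : IsCompact P := by
  obtain ⟨s, hs, rfl⟩ := hP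
  exact hs.isCompact_convexHull ℝ

lemma IsPolytope.convex (hP : IsPolytope P) : Convex ℝ P := by
  obtain ⟨s, hs, rfl⟩ := hP
  exact convex_convexHull ℝ s

lemma IsPolytope.finite_extremePoints (hP : IsPolytope P) : (P.extremePoints ℝ).Finite := by
  obtain ⟨s, hs, rfl⟩ := hP
  exact hs.subset extremePoints_convexHull_subset

lemma IsPolytope.eq_convexHull_inter (hP : IsPolytope P) {F : Set (Fin n → ℝ)}
    (hF : IsExposed ℝ P F) : F = convexHull ℝ (F ∩ P.extremePoints ℝ) := by
  have h := hF.isExtreme.extremePoints_eq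
  rw [← h]
  refine eq_convexHull_extremePoints (hF.isCompact hP.isCompact) (hF.convex hP.convex) ?_
  rw [h]
  exact hP.finite_extremePoints.inter_of_right _

/-- An extreme point is strictly separated from the hull of the finitely many others, so the face
maximizing the separating functional has no other extreme point. -/
lemma IsPolytope.vertices_eq (hP : IsPolytope P) : vertices P = P.extremePoints ℝ := by
  ext x
  constructor
  · intro hx
    exact isExtreme_singleton.1 (IsExposed.isExtreme hx)
  · intro hx
    have hfin := hP.finite_extremePoints
    have hxP : x ∈ P := hx.1
    have hnot : x ∉ convexHull ℝ (P.extremePoints ℝ \ {x}) := by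
      intro hmem
      have hsub : convexHull ℝ (P.extremePoints ℝ \ {x}) ⊆ P \ {x} :=
        convexHull_min (Set.sdiff_subset_sdiff_left extremePoints_subset)
          (hP.convex.mem_extremePoints_iff_convex_sdiff.1 hx).2
      exact (hsub hmem).2 rfl
    obtain ⟨f, u, hfx, hfu⟩ := geometric_hahn_banach_point_closed (convex_convexHull ℝ _)
      ((hfin.subset Set.sdiff_subset).isClosed_convexHull ℝ) hnot
    have hF : IsExposed ℝ P ((-f).toExposed P) := ContinuousLinearMap.toExposed.isExposed
    have hFne : ((-f).toExposed P).Nonempty := by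
      obtain ⟨y, hy, hmax⟩ := hP.isCompact.exists_isMaxOn ⟨x, hxP⟩ (-f).continuous.continuousOn
      exact ⟨y, hy, fun z hz => hmax hz⟩
    have hsub : (-f).toExposed P ∩ P.extremePoints ℝ ⊆ {x} := by
      rintro y ⟨⟨-, hy⟩, hyE⟩
      by_contra hyx
      have h1 := hfu y (subset_convexHull ℝ _ ⟨hyE, hyx⟩)
      have h2 := hy x hxP
      simp only [neg_apply] at h2
      linarith
    have hFx : (-f).toExposed P = {x} := by
      refine (Set.Nonempty.subset_singleton_iff hFne).1 ?_
      rw [hP.eq_convexHull_inter hF]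
      exact (convexHull_mono hsub).trans (convexHull_singleton x).subset
    rwa [hFx] at hF

lemma IsPolytope.finite_vertices (hP : IsPolytope P) : (vertices P).Finite :=
  hP.vertices_eq ▸ hP.finite_extremePoints

lemma IsPolytope.eq_convexHull (hP : IsPolytope P) {F : Set (Fin n → ℝ)}
    (hF : IsExposed ℝ P F) : F = convexHull ℝ (F ∩ vertices P) :=
  hP.vertices_eq ▸ hP.eq_convexHull_inter hF

lemma vertices_subset : vertices P ⊆ P := fun _ hx => IsExposed.subset hx rfl

/-- A vertex on a segment in `P` is an endpoint. -/
lemma IsPolytope.eq_of_mem_segment (hP : IsPolytope P) {x y z : Fin n → ℝ} (hx : x ∈ P)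
    (hy : y ∈ P) (hz : z ∈ vertices P) (hseg : z ∈ segment ℝ x y) : z = x ∨ z = y := by
  rw [hP.vertices_eq] at hz
  rw [← insert_endpoints_openSegment] at hseg
  rcases hseg with h | h | h
  · exact Or.inl h
  · exact Or.inr h
  · exact Or.inl ((mem_extremePoints.1 hz).2 x hx y hy h).1.symm

/-- The vertices of `P`, placed at height one. -/
def lift (P : Set (Fin n → ℝ)) (v : vertices P) : (Fin n → ℝ) × ℝ := (v, 1)

open scoped Classical in
/-- The vertices in `F`. -/
noncomputable def vertexFinset [Fintype (vertices P)] (F : Set (Fin n → ℝ)) :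
    Finset (vertices P) := Finset.univ.filter fun v => (v : Fin n → ℝ) ∈ F

lemma mem_vertexFinset [Fintype (vertices P)] {F : Set (Fin n → ℝ)} {v : vertices P} :
    v ∈ vertexFinset F ↔ (v : Fin n → ℝ) ∈ F := by simp [vertexFinset]

lemma isFace_vertexFinset [Fintype (vertices P)] {F : Set (Fin n → ℝ)} (hF : IsExposed ℝ P F) :
    IsFace (lift P) (vertexFinset F) := by
  rcases F.eq_empty_or_nonempty with rfl | hne
  · exact ⟨LinearMap.snd ℝ _ _, by simp [lift], by simp [lift, mem_vertexFinset]⟩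
  obtain ⟨l, hl⟩ := hF hne
  obtain ⟨x, hx⟩ := hne
  have hx' : x ∈ P ∧ ∀ y ∈ P, l y ≤ l x := by rwa [hl] at hx
  refine ⟨(l x) • LinearMap.snd ℝ _ _ - (l : (Fin n → ℝ) →ₗ[ℝ] ℝ) ∘ₗ LinearMap.fst ℝ _ _,
    fun v => ?_, fun v => ?_⟩
  · simpa [lift] using hx'.2 v (vertices_subset v.2)
  · rw [mem_vertexFinset, hl]
    simp only [lift, LinearMap.sub_apply, LinearMap.smul_apply, LinearMap.snd_apply, smul_eq_mul,
      mul_one, LinearMap.comp_apply, LinearMap.fst_apply, ContinuousLinearMap.coe_coe,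
      Set.mem_ofPred_eq, sub_eq_zero]
    constructor
    · exact fun h => ⟨vertices_subset v.2, fun y hy => h ▸ hx'.2 y hy⟩
    · exact fun h => le_antisymm (h.2 x hx'.1) (hx'.2 v h.1)

/-- At height one a linear functional on the cone is an affine function on `P`, whose zero set is
exposed when it is nonnegative at the vertices. -/
lemma IsPolytope.exists_isExposed (hP : IsPolytope P) [Fintype (vertices P)]
    {A : Finset (vertices P)} (hA : IsFace (lift P) A) :
    ∃ F, IsExposed ℝ P F ∧ vertexFinset F = A := by
  obtain ⟨m, hm, hmA⟩ := hA
  let l : (Fin n → ℝ) →L[ℝ] ℝ := -(LinearMap.toContinuousLinearMap (m ∘ₗ LinearMap.inl ℝ _ _))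
  have hsplit : ∀ x : Fin n → ℝ, m (x, 1) = m (0, 1) - l x := by
    intro x
    have : ((x, 1) : (Fin n → ℝ) × ℝ) = (0, 1) + (x, 0) := by simp
    rw [this, map_add]
    simp [l]
  have hle : ∀ x ∈ P, l x ≤ m (0, 1) := by
    have hconv : Convex ℝ {x | l x ≤ m (0, 1)} :=
      convex_halfSpace_le l.toLinearMap.isLinear _
    have hsub : P ⊆ {x | l x ≤ m (0, 1)} := by
      rw [hP.eq_convexHull (IsExposed.refl P)]
      refine convexHull_min ?_ hconv
      rintro x ⟨-, hx⟩
      have := hm ⟨x, hx⟩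
      rw [lift, hsplit] at this
      simpa using this
    exact hsub
  refine ⟨{x ∈ P | l x = m (0, 1)}, ?_, ?_⟩
  · rintro ⟨x0, hx0, hx0'⟩
    refine ⟨l, Set.ext fun x => ?_⟩
    simp only [Set.mem_ofPred_eq]
    constructor
    · exact fun h => ⟨h.1, fun y hy => h.2 ▸ hle y hy⟩
    · exact fun h => ⟨h.1, le_antisymm (hle x h.1) (hx0' ▸ h.2 x0 hx0)⟩
  · ext v
    rw [mem_vertexFinset, ← hmA, lift, hsplit v, sub_eq_zero]
    exact ⟨fun h => h.2.symm, fun h => ⟨vertices_subset v.2, h.symm⟩⟩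

lemma IsPolytope.eq_convexHull_vertexFinset (hP : IsPolytope P) [Fintype (vertices P)]
    {F : Set (Fin n → ℝ)} (hF : IsExposed ℝ P F) :
    F = convexHull ℝ (Subtype.val '' ((vertexFinset F : Finset (vertices P)) : Set (vertices P))) := by
  conv_lhs => rw [hP.eq_convexHull hF]
  congr 1
  ext x
  simp only [Set.mem_inter_iff, Set.mem_image, Finset.mem_coe, mem_vertexFinset, Subtype.exists,
    exists_and_left, exists_prop, exists_eq_right_right]

/-- The face lattice in terms of vertex sets. -/
noncomputable def IsPolytope.faceOrderIso (hP : IsPolytope P) [Fintype (vertices P)] :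
    Face P ≃o {A : Finset (vertices P) // IsFace (lift P) A} :=
  OrderIso.ofSurjective (OrderEmbedding.ofMapLEIff
    (fun F : Face P => (⟨vertexFinset F.1, isFace_vertexFinset F.2⟩ :
      {A : Finset (vertices P) // IsFace (lift P) A}))
    fun F F' => by
      constructor
      · intro h
        change F.1 ⊆ F'.1
        rw [hP.eq_convexHull_vertexFinset F.2, hP.eq_convexHull_vertexFinset F'.2]
        exact convexHull_mono (Set.image_mono (Finset.coe_subset.2 h))
      · intro h v hv
        exact mem_vertexFinset.2 (h (mem_vertexFinset.1 hv)))
    fun A => by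
      obtain ⟨F, hF, hFA⟩ := hP.exists_isExposed A.2
      exact ⟨⟨F, hF⟩, Subtype.ext hFA⟩

lemma IsPolytope.realizes (hP : IsPolytope P) [Fintype (vertices P)] [DecidableEq (vertices P)] :
    Realizes (graph P) (lift P) where
  pos := ⟨LinearMap.snd ℝ _ _, by simp [lift]⟩
  vertex v := by
    have := isFace_vertexFinset v.2
    convert this
    ext u
    simp [mem_vertexFinset, Subtype.ext_iff]
  adj_iff v w := by
    refine and_congr_right fun hvw => ⟨fun h => ?_, fun h => ?_⟩
    · convert isFace_vertexFinset h
      ext u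
      rw [mem_vertexFinset]
      simp only [Finset.mem_insert, Finset.mem_singleton, Subtype.ext_iff]
      constructor
      · rintro (h | h) <;> rw [h]
        · exact left_mem_segment ℝ _ _
        · exact right_mem_segment ℝ _ _
      · exact hP.eq_of_mem_segment (vertices_subset v.2) (vertices_subset w.2) u.2
    · obtain ⟨F, hF, hFA⟩ := hP.exists_isExposed h
      have := hP.eq_convexHull_vertexFinset hF
      rw [hFA] at this
      simp only [Finset.coe_insert, Finset.coe_singleton, Set.image_pair, convexHull_pair] at this
      rwa [← this]

/-- The span is the direction of the affine hull, at height zero, plus the line of one lifted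
vertex. -/
lemma IsPolytope.finrank_span_lift (hP : IsPolytope P) {k : ℕ} (hk : HasDim P k) :
    Module.finrank ℝ (Submodule.span ℝ (Set.range (lift P))) = k + 1 := by
  obtain ⟨hne, hk⟩ := hk
  have hPV := hP.eq_convexHull (IsExposed.refl P)
  rw [Set.inter_eq_self_of_subset_right vertices_subset] at hPV
  obtain ⟨v0, hv0⟩ : (vertices P).Nonempty := by
    rw [hPV] at hne
    exact convexHull_nonempty_iff.1 hne
  have hvs : vectorSpan ℝ P = vectorSpan ℝ (vertices P) := by
    rw [← direction_affineSpan, ← direction_affineSpan, hPV, affineSpan_convexHull, ← hPV]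
  rw [hvs] at hk
  have hspan : Submodule.span ℝ (Set.range (lift P)) =
      (vectorSpan ℝ (vertices P)).map (LinearMap.inl ℝ (Fin n → ℝ) ℝ) ⊔
        Submodule.span ℝ {lift P ⟨v0, hv0⟩} := by
    rw [vectorSpan_eq_span_vsub_set_right ℝ hv0, Submodule.map_span, ← Submodule.span_union]
    apply le_antisymm
    · rw [Submodule.span_le]
      rintro _ ⟨v, rfl⟩
      have h1 : lift P v = LinearMap.inl ℝ (Fin n → ℝ) ℝ (v - v0) + lift P ⟨v0, hv0⟩ := by
        simp [lift]
      rw [h1]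
      refine Submodule.add_mem _ (Submodule.subset_span (Or.inl ?_))
        (Submodule.subset_span (Or.inr rfl))
      exact ⟨_, ⟨v, v.2, rfl⟩, rfl⟩
    · rw [Submodule.span_le]
      rintro _ (⟨_, ⟨v, hv, rfl⟩, rfl⟩ | rfl)
      · have h1 : LinearMap.inl ℝ (Fin n → ℝ) ℝ (v -ᵥ v0) =
            lift P ⟨v, hv⟩ - lift P ⟨v0, hv0⟩ := by simp [lift]
        rw [h1]
        exact Submodule.sub_mem _ (Submodule.subset_span ⟨_, rfl⟩) (Submodule.subset_span ⟨_, rfl⟩)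
      · exact Submodule.subset_span ⟨_, rfl⟩
  have hinf : (vectorSpan ℝ (vertices P)).map (LinearMap.inl ℝ (Fin n → ℝ) ℝ) ⊓
      Submodule.span ℝ {lift P ⟨v0, hv0⟩} = ⊥ := by
    rw [eq_bot_iff]
    rintro _ ⟨⟨a, -, rfl⟩, hb⟩
    obtain ⟨c, hc⟩ := Submodule.mem_span_singleton.1 hb
    have h2 := congrArg Prod.snd hc
    simp only [lift, Prod.smul_mk, smul_eq_mul, mul_one, LinearMap.inl_apply] at h2
    rw [← hc, h2, zero_smul]
    exact Submodule.zero_mem _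
  have hsum := Submodule.finrank_sup_add_finrank_inf_eq
    ((vectorSpan ℝ (vertices P)).map (LinearMap.inl ℝ (Fin n → ℝ) ℝ))
    (Submodule.span ℝ {lift P ⟨v0, hv0⟩})
  rw [hinf, finrank_bot, add_zero, ← hspan, finrank_span_singleton (by simp [lift]),
    ← (Submodule.equivMapOfInjective _ LinearMap.inl_injective _).finrank_eq, hk] at hsum
  exact hsum

end Polytope

/-! ### Relabelling vertices and the reconstruction theorem -/

section Transport

variable {V V' W : Type*} [Fintype V] [DecidableEq V] [Fintype V'] [DecidableEq V']
  [AddCommGroup W] [Module ℝ W] {G : SimpleGraph V} {G' : SimpleGraph V'} {p : V → W}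

lemma isFace_comp_iff (e : V' ≃ V) {A : Finset V'} :
    IsFace (p ∘ e) A ↔ IsFace p (A.map e.toEmbedding) := by
  refine exists_congr fun l => and_congr ?_ ?_
  · exact e.forall_congr_left.trans (by simp)
  · rw [e.forall_congr_left]
    simp [Finset.mem_map_equiv]

lemma Realizes.comp (h : Realizes G p) (e : G' ≃g G) : Realizes G' (p ∘ e.toEquiv) where
  pos := by
    obtain ⟨l, hl⟩ := h.pos
    exact ⟨l, fun i => hl _⟩
  vertex i := by
    rw [isFace_comp_iff]
    simpa using h.vertex (e.toEquiv i)
  adj_iff i j := by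
    rw [isFace_comp_iff, ← e.map_adj_iff, h.adj_iff]
    simp [Finset.map_insert]

end Transport

/-- A polytope with at most two nonsimple vertices is reconstructible from its graph. -/
theorem IsPolytope.reconstructibleFromGraph {m : ℕ} {Q : Set (Fin m → ℝ)} (hQ : IsPolytope Q)
    [Fintype (vertices Q)] (S : Set (vertices Q)) (hS : S.encard ≤ 2)
    (hsimple : ∀ k, HasDim Q k → ∀ x, x ∉ S → (nbr (graph Q) x).card = k) :
    ReconstructibleFromGraph Q := by
  classical
  rintro k hQk n P hP hPk ⟨e⟩
  have : Fintype (vertices P) := hP.finite_vertices.fintype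
  obtain ⟨f, hf⟩ : ∃ f : graph Q ≃g graph P, f = e.symm := ⟨_, rfl⟩
  have hp : Realizes (graph Q) (lift P ∘ f.toEquiv) := hP.realizes.comp f
  have hfin : Module.finrank ℝ (Submodule.span ℝ (Set.range (lift P ∘ f.toEquiv))) = k + 1 := by
    rw [f.toEquiv.surjective.range_comp]
    exact hP.finrank_span_lift hPk
  have key : ∀ A, IsFace (lift P ∘ f.toEquiv) A ↔ IsFace (lift Q) A := by
    -- Two distinct vertices `v`, `w` are needed below; with at most one vertex, only the empty and
    -- the full vertex set arise.
    rcases subsingleton_or_nontrivial (vertices Q) with hsub | hnt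
    · intro A
      rcases A.eq_empty_or_nonempty with rfl | ⟨x, hx⟩
      · exact iff_of_true hp.isFace_empty hQ.realizes.isFace_empty
      · have : A = Finset.univ :=
          Finset.eq_univ_iff_forall.2 fun y => Subsingleton.elim x y ▸ hx
        rw [this]
        exact iff_of_true isFace_univ isFace_univ
    · obtain ⟨v, w, hvw, hSvw⟩ : ∃ v w, v ≠ w ∧ ∀ x ∈ S, x = v ∨ x = w := by
        obtain ⟨v, hv⟩ : ∃ v, v ∈ S ∨ S = ∅ := by
          rcases S.eq_empty_or_nonempty with h | ⟨v, hv⟩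
          · exact ⟨hnt.exists_pair_ne.choose, Or.inr h⟩
          · exact ⟨v, Or.inl hv⟩
        by_cases hw : ∃ w ∈ S, w ≠ v
        · obtain ⟨w, hw, hwv⟩ := hw
          refine ⟨v, w, hwv.symm, fun x hx => ?_⟩
          by_contra! hcon
          have hvS : v ∈ S := hv.resolve_right fun h0 => by simp [h0] at hx
          have hsub : ({x, v, w} : Set (vertices Q)) ⊆ S := by
            rintro y (rfl | rfl | rfl) <;> assumption
          have h3 : ({x, v, w} : Set (vertices Q)).encard = 3 :=
            Set.encard_eq_three.2 ⟨x, v, w, hcon.1, hcon.2, hwv.symm, rfl⟩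
          have h4 := (Set.encard_le_encard hsub).trans hS
          rw [h3] at h4
          exact absurd h4 (by decide)
        · push Not at hw
          obtain ⟨w, hwv⟩ := exists_ne v
          exact ⟨v, w, hwv.symm, fun x hx => Or.inl (hw x hx)⟩
      -- Simplicity passes to `P`, since it compares a degree of the common graph with the common
      -- dimension.
      have hpair : AlmostSimplePair (graph Q) (lift P ∘ f.toEquiv) (lift Q) v w := by
        refine ⟨hp, hQ.realizes, hvw, fun x hxv hxw => ?_, fun x hxv hxw => ?_⟩ <;>
          unfold IsSimple <;> rw [hsimple k hQk x fun hx => (hSvw x hx).elim hxv hxw]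
        · exact hfin.symm
        · exact (hQ.finrank_span_lift hQk).symm
      exact hpair.isFace_iff
  refine ⟨hP.faceOrderIso.trans (OrderIso.trans ?_ hQ.faceOrderIso.symm)⟩
  refine OrderIso.symm ⟨(Equiv.finsetCongr f.toEquiv).subtypeEquiv fun A => ?_, ?_⟩
  · rw [← key, isFace_comp_iff]
    rfl
  · rintro ⟨A, hA⟩ ⟨B, hB⟩
    exact Finset.map_subset_map

/-! ### Vertices and edges of slices of the cube -/

section Cube

variable {d : ℕ} {u : Fin d → ℝ} {t : ℝ} {x : Fin d → ℝ}

lemma eventually_add_smul_mem_cube (hx : x ∈ cube d) {δ : Fin d → ℝ}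
    (h1 : ∀ j, x j = 1 → δ j ≤ 0) (h2 : ∀ j, x j = -1 → 0 ≤ δ j) :
    ∀ᶠ ε in nhdsWithin (0 : ℝ) (Set.Ioi 0), x + ε • δ ∈ cube d := by
  simp only [cube, Set.mem_ofPred_eq, Filter.eventually_all, Pi.add_apply, Pi.smul_apply,
    smul_eq_mul]
  intro j
  have hxj := hx j
  refine Filter.Eventually.and ?_ ?_
  · rcases hxj.1.eq_or_lt with h | h
    · filter_upwards [self_mem_nhdsWithin] with ε hε
      have := mul_nonneg (le_of_lt hε) (h2 j h.symm)
      linarith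
    · refine nhdsWithin_le_nhds (Filter.Eventually.mono ?_ fun _ h => le_of_lt h)
      exact ContinuousAt.eventually_lt (by fun_prop) (by fun_prop) (by simpa using h)
  · rcases hxj.2.eq_or_lt with h | h
    · filter_upwards [self_mem_nhdsWithin] with ε hε
      have := mul_nonneg (le_of_lt hε) (neg_nonneg.2 (h1 j h))
      linarith
    · refine nhdsWithin_le_nhds (Filter.Eventually.mono ?_ fun _ h => le_of_lt h)
      exact ContinuousAt.eventually_lt (by fun_prop) (by fun_prop) (by simpa using h)

/-- The slice of the cube by the hyperplane `⟨u, x⟩ = t`. -/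
def slice (d : ℕ) (u : Fin d → ℝ) (t : ℝ) : Set (Fin d → ℝ) := cube d ∩ {x | u ⬝ᵥ x = t}

lemma eventually_add_smul_mem_slice (hx : x ∈ slice d u t) {δ : Fin d → ℝ}
    (h1 : ∀ j, x j = 1 → δ j ≤ 0) (h2 : ∀ j, x j = -1 → 0 ≤ δ j) (hu : u ⬝ᵥ δ = 0) :
    ∀ᶠ ε in nhdsWithin (0 : ℝ) (Set.Ioi 0), x + ε • δ ∈ slice d u t := by
  filter_upwards [eventually_add_smul_mem_cube hx.1 h1 h2] with ε hε
  refine ⟨hε, ?_⟩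
  have := hx.2
  simp only [Set.mem_ofPred_eq] at this ⊢
  rw [dotProduct_add, dotProduct_smul, hu, this]
  simp

/-- Such a direction stays in all tight facets and in the hyperplane, so it can be followed both
ways inside the slice. -/
lemma eq_zero_of_extreme (hx : x ∈ (slice d u t).extremePoints ℝ) {δ : Fin d → ℝ}
    (h : ∀ j, x j = 1 ∨ x j = -1 → δ j = 0) (hu : u ⬝ᵥ δ = 0) : δ = 0 := by
  have h1 := eventually_add_smul_mem_slice hx.1 (δ := δ) (fun j hj => (h j (Or.inl hj)).le)
    (fun j hj => (h j (Or.inr hj)).ge) hu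
  have h2 := eventually_add_smul_mem_slice hx.1 (δ := -δ) (fun j hj => by simp [h j (Or.inl hj)])
    (fun j hj => by simp [h j (Or.inr hj)]) (by simp [hu])
  obtain ⟨ε, ⟨h1, h2⟩, hε⟩ := ((h1.and h2).and self_mem_nhdsWithin).exists
  have hseg : x ∈ openSegment ℝ (x + ε • δ) (x + ε • -δ) :=
    ⟨1 / 2, 1 / 2, by norm_num, by norm_num, by norm_num, by module⟩
  have h3 := ((mem_extremePoints.1 hx).2 _ h1 _ h2 hseg).1
  simpa [(show (0 : ℝ) < ε from hε).ne'] using h3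

/-- An extreme point of a slice has at most one coordinate different from `±1`, and the hyperplane
is transversal to the corresponding edge of the cube. -/
lemma extreme_coord (hx : x ∈ (slice d u t).extremePoints ℝ) {i : Fin d}
    (hi : ¬ (x i = 1 ∨ x i = -1)) : u i ≠ 0 ∧ ∀ j, j ≠ i → x j = 1 ∨ x j = -1 := by
  have hui : u i ≠ 0 := by
    intro hui
    have := eq_zero_of_extreme hx (δ := Pi.single i 1)
      (fun j hj => Pi.single_eq_of_ne (by rintro rfl; exact hi hj) _) (by simp [hui])
    simpa using congrFun this i
  refine ⟨hui, fun j hji => ?_⟩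
  by_contra hj
  have := eq_zero_of_extreme hx (δ := Pi.single i (u j) - Pi.single j (u i)) (fun l hl => by
    have h1 : l ≠ i := by rintro rfl; exact hi hl
    have h2 : l ≠ j := by rintro rfl; exact hj hl
    simp [h1, h2]) (by simp [dotProduct_sub, mul_comm])
  have := congrFun this j
  simp [hji, hui] at this

lemma isCompact_cube (d : ℕ) : IsCompact (cube d) := by
  have : cube d = Set.univ.pi fun _ => Set.Icc (-1 : ℝ) 1 := by
    ext x
    simp [cube, Pi.le_def, forall_and]
  rw [this]
  exact isCompact_univ_pi fun _ => isCompact_Icc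

lemma convex_cube (d : ℕ) : Convex ℝ (cube d) := by
  have : cube d = Set.univ.pi fun _ => Set.Icc (-1 : ℝ) 1 := by
    ext x
    simp [cube, Pi.le_def, forall_and]
  rw [this]
  exact convex_pi fun _ _ => convex_Icc _ _

lemma finite_extremePoints_slice : ((slice d u t).extremePoints ℝ).Finite := by
  have hfin : (Set.univ.pi fun _ : Fin d => ({1, -1} : Set ℝ)).Finite :=
    Set.Finite.pi fun _ => Set.toFinite _
  refine (hfin.union (Set.finite_iUnion fun i : Fin d => hfin.image fun σ =>
    Function.update σ i ((t - u ⬝ᵥ Function.update σ i 0) / u i))).subset ?_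
  intro x hx
  by_cases hall : ∀ i, x i = 1 ∨ x i = -1
  · exact Or.inl fun i _ => hall i
  push Not at hall
  obtain ⟨i, hi⟩ := hall
  obtain ⟨hui, hj⟩ := extreme_coord hx (not_or.2 hi)
  -- The entry at `i` is overwritten by 1 only to obtain a sign vector; its true value is recovered
  -- from the equation of the hyperplane.
  refine Or.inr (Set.mem_iUnion.2 ⟨i, Function.update x i 1, fun j _ => ?_, ?_⟩)
  · by_cases hji : j = i
    · simp [hji]
    · simpa [hji] using hj j hji
  · have ht : u ⬝ᵥ x = t := hx.1.2
    have hsplit : x = Function.update x i 0 + Pi.single i (x i) := by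
      ext j
      by_cases hji : j = i
      · simp [hji]
      · simp [hji]
    have hdot : u ⬝ᵥ x = u ⬝ᵥ Function.update x i 0 + u i * x i := by
      conv_lhs => rw [hsplit, dotProduct_add, dotProduct_single]
    simp only [Function.update_idem]
    rw [← ht, hdot, add_sub_cancel_left, mul_div_cancel_left₀ _ hui, Function.update_eq_self]

lemma isPolytope_slice (d : ℕ) (u : Fin d → ℝ) (t : ℝ) : IsPolytope (slice d u t) := by
  have hclosed : IsClosed {x : Fin d → ℝ | u ⬝ᵥ x = t} :=
    isClosed_eq (by fun_prop) continuous_const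
  have hconv : Convex ℝ {x : Fin d → ℝ | u ⬝ᵥ x = t} :=
    convex_hyperplane ⟨dotProduct_add u, fun c x => dotProduct_smul c u x⟩ t
  exact ⟨_, finite_extremePoints_slice, eq_convexHull_extremePoints
    ((isCompact_cube d).inter_right hclosed) ((convex_cube d).inter hconv)
    finite_extremePoints_slice⟩

lemma mem_vertices_cube (hx : ∀ i, x i = 1 ∨ x i = -1) : x ∈ vertices (cube d) := by
  intro _
  have hsq : ∀ i, x i * x i = 1 := fun i => by rcases hx i with h | h <;> simp [h]
  have hle : ∀ y ∈ cube d, ∀ i, x i * y i ≤ x i * x i := fun y hy i => by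
    have := hy i
    rcases hx i with h | h <;> rw [h] <;> linarith
  have hxc : x ∈ cube d := fun i => by rcases hx i with h | h <;> rw [h] <;> norm_num
  refine ⟨LinearMap.toContinuousLinearMap (dotProductBilin ℝ ℝ x), ?_⟩
  ext y
  simp only [Set.mem_singleton_iff, Set.mem_ofPred_eq, LinearMap.coe_toContinuousLinearMap',
    dotProductBilin_apply_apply]
  constructor
  · rintro rfl
    exact ⟨hxc, fun z hz => Finset.sum_le_sum fun i _ => hle z hz i⟩
  · rintro ⟨hy, hmax⟩
    have h1 := (Finset.sum_eq_sum_iff_of_le fun i _ => hle y hy i).1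
      (le_antisymm (Finset.sum_le_sum fun i _ => hle y hy i) (hmax x hxc))
    ext i
    have h2 := h1 i (Finset.mem_univ i)
    exact mul_left_cancel₀ (fun h0 => by simpa [h0] using hsq i) h2

/-- An edge of the slice at an extreme point in the relative interior of an edge of the cube
leaves exactly one of the facets of the cube through this point. -/
lemma edge_direction {y : Fin d → ℝ} (hx : x ∈ (slice d u t).extremePoints ℝ) {i : Fin d}
    (hi : ¬ (x i = 1 ∨ x i = -1)) (hxy : x ≠ y)
    (hseg : IsExposed ℝ (slice d u t) (segment ℝ x y)) :
    ∃ j, j ≠ i ∧ y j ≠ x j ∧ ∀ l, l ≠ i → l ≠ j → y l = x l := by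
  obtain ⟨hui, -⟩ := extreme_coord hx hi
  have hy : y ∈ slice d u t := hseg.subset (right_mem_segment ℝ x y)
  have hudot : u ⬝ᵥ (y - x) = 0 := by
    have h1 : u ⬝ᵥ x = t := hx.1.2
    have h2 : u ⬝ᵥ y = t := hy.2
    rw [dotProduct_sub, h1, h2, sub_self]
  obtain ⟨j, hji, hj⟩ : ∃ j, j ≠ i ∧ y j ≠ x j := by
    by_contra! hcon
    have hsingle : y - x = Pi.single i (y i - x i) := by
      ext l
      by_cases hli : l = i
      · simp [hli]
      · simp [hli, hcon l hli]
    rw [hsingle, dotProduct_single, mul_eq_zero, or_iff_right hui] at hudot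
    rw [hudot, Pi.single_zero, sub_eq_zero] at hsingle
    exact hxy hsingle.symm
  refine ⟨j, hji, hj, fun l hli hlj => ?_⟩
  by_contra hl
  -- The `j`-part of `y - x`, corrected along `i` to stay in the hyperplane. Both `δ` and `y - x -
  -- δ` point into the slice, so extremality of the edge forces `δ` to be parallel to `y - x`,
  -- although it vanishes at `l`.
  obtain ⟨δ, hδ⟩ : ∃ δ : Fin d → ℝ,
      δ = Pi.single j (y j - x j) - Pi.single i (u j * (y j - x j) / u i) := ⟨_, rfl⟩
  have hδj : δ j = y j - x j := by simp [hδ, hji]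
  have hδ0 : ∀ m, m ≠ i → m ≠ j → δ m = 0 := fun m hmi hmj => by simp [hδ, hmi, hmj]
  have hδu : u ⬝ᵥ δ = 0 := by
    rw [hδ, dotProduct_sub, dotProduct_single, dotProduct_single]
    field_simp
    ring
  have hne : ∀ m, x m = 1 ∨ x m = -1 → m ≠ i := by
    rintro m hm rfl
    exact hi hm
  have hsign1 : ∀ m, x m = 1 → y m - x m ≤ 0 := fun m hm => by linarith [(hy.1 m).2]
  have hsign2 : ∀ m, x m = -1 → 0 ≤ y m - x m := fun m hm => by linarith [(hy.1 m).1]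
  have h1 := eventually_add_smul_mem_slice hx.1 (δ := δ)
    (fun m hm => by
      by_cases hmj : m = j
      · rw [hmj, hδj]; exact hsign1 j (hmj ▸ hm)
      · exact (hδ0 m (hne m (Or.inl hm)) hmj).le)
    (fun m hm => by
      by_cases hmj : m = j
      · rw [hmj, hδj]; exact hsign2 j (hmj ▸ hm)
      · exact (hδ0 m (hne m (Or.inr hm)) hmj).ge) hδu
  have h2 := eventually_add_smul_mem_slice hx.1 (δ := y - x - δ)
    (fun m hm => by
      by_cases hmj : m = j
      · simp [hmj, hδj]
      · simpa [hδ0 m (hne m (Or.inl hm)) hmj] using hsign1 m hm)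
    (fun m hm => by
      by_cases hmj : m = j
      · simp [hmj, hδj]
      · simpa [hδ0 m (hne m (Or.inr hm)) hmj] using hsign2 m hm)
    (by rw [dotProduct_sub, hudot, hδu, sub_zero])
  have h3 : ∀ᶠ ε in nhdsWithin (0 : ℝ) (Set.Ioi 0), ε < 1 :=
    nhdsWithin_le_nhds (Iio_mem_nhds one_pos)
  obtain ⟨ε, ⟨⟨h1, h2⟩, h3⟩, hε⟩ := (((h1.and h2).and h3).and self_mem_nhdsWithin).exists
  have hε : 0 < ε := hε
  have hmid : x + (ε / 2) • (y - x) ∈ segment ℝ x y :=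
    ⟨1 - ε / 2, ε / 2, by linarith, by linarith, by ring, by module⟩
  have hopen : x + (ε / 2) • (y - x) ∈ openSegment ℝ (x + ε • δ) (x + ε • (y - x - δ)) :=
    ⟨1 / 2, 1 / 2, by norm_num, by norm_num, by norm_num, by module⟩
  have hmem := hseg.isExtreme.left_mem_of_mem_openSegment h1 h2 hmid hopen
  rw [segment_eq_image'] at hmem
  obtain ⟨s, -, hs⟩ := hmem
  have hsl := congrFun hs l
  have hsj := congrFun hs j
  simp only [Pi.add_apply, Pi.smul_apply, Pi.sub_apply, smul_eq_mul, hδ0 l hli hlj, hδj, mul_zero,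
    add_right_inj, mul_eq_zero, sub_eq_zero, hl, or_false] at hsl hsj
  rw [hsl, zero_mul, zero_eq_mul, sub_eq_zero] at hsj
  rcases hsj with h | h
  · exact hε.ne' h
  · exact hj h

lemma card_nbr_of_not_vertex [Fintype (vertices (slice d u t))]
    (hdim : HasDim (slice d u t) (d - 1)) (x : vertices (slice d u t))
    (hx : (x : Fin d → ℝ) ∉ vertices (cube d)) :
    (nbr (graph (slice d u t)) x).card = d - 1 := by
  classical
  have hP := isPolytope_slice d u t
  have hvE : ∀ y : vertices (slice d u t), (y : Fin d → ℝ) ∈ (slice d u t).extremePoints ℝ :=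
    fun y => hP.vertices_eq ▸ y.2
  obtain ⟨i, hi⟩ : ∃ i, ¬ ((x : Fin d → ℝ) i = 1 ∨ (x : Fin d → ℝ) i = -1) := by
    by_contra! hcon
    exact hx (mem_vertices_cube hcon)
  obtain ⟨hui, hpm⟩ := extreme_coord (hvE x) hi
  apply le_antisymm
  · have : Nonempty (Fin d) := ⟨i⟩
    choose! J hJi hJ hJ0 using fun (y : vertices (slice d u t))
      (hy : (graph (slice d u t)).Adj x y) => edge_direction (hvE x) hi
        (fun h => hy.1 (Subtype.ext h)) hy.2
    have hcard : (Finset.univ.erase i).card = d - 1 := by simp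
    rw [← hcard]
    refine Finset.card_le_card_of_injOn J (fun y hy => ?_) ?_
    · simpa using hJi y (mem_nbr.1 hy)
    · intro y hy z hz hyz
      replace hy := mem_nbr.1 hy
      replace hz := mem_nbr.1 hz
      have hxi : ∀ a : vertices (slice d u t), u ⬝ᵥ (a : Fin d → ℝ) = t := fun a => (hvE a).1.2
      have hyj := hJ y hy
      have hzj : (z : Fin d → ℝ) (J y) ≠ (x : Fin d → ℝ) (J y) := hyz ▸ hJ z hz
      -- This ratio cancels coordinate `J y` of `z - x - c • (y - x)`, which leaves a multiple of
      -- the `i`-th unit vector orthogonal to `u`, hence zero. Both neighbours move inward from the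
      -- facet, so `0 < c`, and one lies on the segment from `x` to the other.
      obtain ⟨c, hc⟩ : ∃ c, c = ((z : Fin d → ℝ) (J y) - (x : Fin d → ℝ) (J y)) /
        ((y : Fin d → ℝ) (J y) - (x : Fin d → ℝ) (J y)) := ⟨_, rfl⟩
      have hη : (z - x : Fin d → ℝ) - c • (y - x : Fin d → ℝ) =
          Pi.single i (((z - x : Fin d → ℝ) - c • (y - x : Fin d → ℝ)) i) := by
        ext l
        by_cases hli : l = i
        · simp [hli]
        by_cases hlj : l = J y
        · have := sub_ne_zero.2 hyj
          simp [hlj, hJi y hy, hc, this]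
        · simp [hli, hJ0 y hy l hli hlj, hJ0 z hz l hli (hyz ▸ hlj)]
      have hdot : u ⬝ᵥ ((z - x : Fin d → ℝ) - c • (y - x : Fin d → ℝ)) = 0 := by
        simp [dotProduct_sub, hxi]
      rw [hη, dotProduct_single, mul_eq_zero, or_iff_right hui] at hdot
      rw [hdot, Pi.single_zero, sub_eq_zero] at hη
      have hc0 : 0 < c := by
        have hy1 := (hvE y).1.1 (J y)
        have hz1 := (hvE z).1.1 (J y)
        rw [hc]
        rcases hpm (J y) (hJi y hy) with h | h <;> rw [h] at hyj hzj ⊢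
        · exact div_pos_of_neg_of_neg (sub_neg.2 (lt_of_le_of_ne hz1.2 hzj))
            (sub_neg.2 (lt_of_le_of_ne hy1.2 hyj))
        · exact div_pos (sub_pos.2 (lt_of_le_of_ne hz1.1 hzj.symm))
            (sub_pos.2 (lt_of_le_of_ne hy1.1 hyj.symm))
      have hmem : ∀ {a b : vertices (slice d u t)} {r : ℝ}, a ≠ x → 0 < r → r ≤ 1 →
          (a - x : Fin d → ℝ) = r • (b - x : Fin d → ℝ) → a = b := by
        intro a b r hax hr0 hr1 hab
        have hseg : (a : Fin d → ℝ) ∈ segment ℝ (x : Fin d → ℝ) b := by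
          rw [segment_eq_image']
          exact ⟨r, ⟨hr0.le, hr1⟩, by simp [← hab]⟩
        exact Subtype.ext ((hP.eq_of_mem_segment (hvE x).1 (hvE b).1 a.2 hseg).resolve_left
          fun h => hax (Subtype.ext h))
      rcases le_total c 1 with hc1 | hc1
      · exact (hmem hz.ne' hc0 hc1 hη).symm
      · refine hmem hy.ne' (inv_pos.2 hc0) (inv_le_one_of_one_le₀ hc1) ?_
        rw [hη, smul_smul, inv_mul_cancel₀ hc0.ne', one_smul]
  -- Conversely, `x` and its neighbours span the cone, so the degree is at least the dimension.
  · have h1 := hP.realizes.span_eq isFace_univ (Finset.mem_univ x)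
    rw [Finset.inter_univ, Finset.coe_univ, Set.image_univ, ← Finset.coe_image] at h1
    have h2 := finrank_span_finset_le_card (R := ℝ)
      ((insert x (nbr (graph (slice d u t)) x)).image (lift (slice d u t)))
    rw [Set.finrank, h1, hP.finrank_span_lift hdim] at h2
    have h3 := h2.trans (Finset.card_image_le.trans (Finset.card_insert_le _ _))
    omega

end Cube

end CubeSlice

theorem proposition4p1 (d : ℕ) (Q : Set (Fin d → ℝ)) (hQ : CubeSlice.IsSlice d Q)
    (hvert : (Q ∩ CubeSlice.vertices (CubeSlice.cube d)).encard ≤ 2) :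
    CubeSlice.ReconstructibleFromGraph Q := by
  obtain ⟨u, t, -, rfl, hdim⟩ := hQ
  have hP := CubeSlice.isPolytope_slice d u t
  have := hP.finite_vertices.fintype
  refine hP.reconstructibleFromGraph {x | (x : Fin d → ℝ) ∈ CubeSlice.vertices (CubeSlice.cube d)}
    ?_ fun k hk x hx => ?_
  · rw [← Subtype.val_injective.encard_image]
    refine (Set.encard_le_encard ?_).trans hvert
    rintro _ ⟨x, hx, rfl⟩
    exact ⟨CubeSlice.vertices_subset x.2, hx⟩
  · rw [CubeSlice.card_nbr_of_not_vertex hdim x hx]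
    exact hdim.2.symm.trans hk.2
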